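/- Let $k\ge 2$ be an integer, $N=2^n$, and let $\mathsf H=\mathsf H_N$ be the $N\times N$ Hadamard (Walsh–Hadamard) matrix normalized to be orthogonal: with rows and columns indexed by $\{0,\dots,N-1\}$, $\mathsf H_{i,j}=(-1)^{\langle i,j\rangle}/\sqrt N$, where $\langle i,j\rangle$ is the inner product of the binary expansions of $i$ and $j$. Let $\varphi(s)=\int_0^s \frac{1}{\sqrt{2\pi}}e^{-t^2/2}\,dt\in[-\frac12,\frac12]$, applied coordinatewise to vectors. For $x=(x_1,\dots,x_{k-1})$ and $y=(y_1,\dots,y_{k-1})$ with $x_\kappa,y_\kappa\in\mathbb R^N$, let $x\diamond y=(x_1,\dots,x_{k-1},\mathbf 1)\odot(\mathbf 1,y_1,\dots,y_{k-1})\in\mathbb R^{kN}$, where $\odot$ is the entrywise product and $\mathbf 1\in\mathbb R^N$ is the all-ones vector. Let $p_0$ be the uniform distribution on $\{\pm1\}^{kN}$. Let $p_1$ be the distribution of $Z\in\{\pm1\}^{kN}$ sampled as follows: let $(U_\kappa,V_\kappa)$, $\kappa=1,\dots,k-1$, be independent centered Gaussian vectors in $\mathbb R^{2N}$ with covariance matrix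 $\begin{pmatrix}\mathsf I_N&\mathsf H_N\\ \mathsf H_N&\mathsf I_N\end{pmatrix}$, put $W=\varphi(U)\diamond\varphi(V)\in[-\frac12,\frac12]^{kN}$, and, given $(U,V)$, let the coordinates of $Z$ be independent signs with means $\mathbb E[Z(i)\mid U,V]=W(i)$. For $\mu\in[-\frac12,\frac12]^{kN}$, let $p_\mu$ be the product measure on $\{\pm1\}^{kN}$ whose $i$-th coordinate has mean $\mu_i$. For $f:\{\pm1\}^{kN}\to\mathbb R$ put $$\hat f^\mu(S)=\mathbb E_{X\sim p_\mu}\Big[f(X)\prod_{i\in S}\frac{X_i-\mu_i}{\sqrt{1-\mu_i^2}}\Big],\qquad \mathsf{wt}^\mu_\ell(f)=\sum_{|S|=\ell}|\hat f^\mu(S)| .$$ **Theorem.** For every $f:\{\pm1\}^{kN}\to[0,1]$, $$\Big|\mathbb E_{p_1}[f(Z)]-\mathbb E_{p_0}[f(Z)]\Big|\;\le\;\sup_{\mu\in[-\frac12,\frac12]^{kN}}\ \sum_{\ell=k}^{k(k-1)}\Big(\frac1{\sqrt N}\Big)^{\ell\left(1-\frac1k\right)}(8k)^{14\ell}\;\mathsf{wt}^\mu_\ell(f),$$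 and the supremum on the right is finite. -/

import Mathlib

open MeasureTheory ProbabilityTheory

namespace Forrelation

noncomputable section

/-! ### Biased product measures and biased Fourier analysis on the cube `{±1}^ι` -/

/-- The cube `{±1}^ι`; the two-element type `ℤˣ = {1, -1}` plays the role of `{±1}`. -/
abbrev Cube (ι : Type*) := ι → ℤˣ

instance : DiscreteMeasurableSpace ℤˣ where
  forall_measurableSet s :=
    ⟨Units.val '' s, trivial, Set.preimage_image_eq s Units.val_injective⟩

/-- The law of a random sign with mean `m`: `1` with probability `(1 + m) / 2`
and `-1` with probability `(1 - m) / 2`. -/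
def biasedSign (m : ℝ) : Measure ℤˣ :=
  ENNReal.ofReal ((1 + m) / 2) • Measure.dirac 1 +
    ENNReal.ofReal ((1 - m) / 2) • Measure.dirac (-1)

/-- The biased product measure `p_μ` on the cube: independent coordinates with means `μ i`. -/
def biasedMeasure {ι : Type*} [Fintype ι] (μ : ι → ℝ) : Measure (Cube ι) :=
  Measure.pi fun i => biasedSign (μ i)

/-- The biased Fourier basis `φ_S^μ(x) = ∏_{i ∈ S} (x_i - μ_i) / √(1 - μ_i²)`. -/
def biasedChar {ι : Type*} (μ : ι → ℝ) (S : Finset ι) (x : Cube ι) : ℝ :=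
  ∏ i ∈ S, (((x i : ℤ) : ℝ) - μ i) / √(1 - μ i ^ 2)

/-- The biased Fourier coefficient `E_{p_μ}[f φ_S^μ]`. -/
def biasedCoeff {ι : Type*} [Fintype ι] (μ : ι → ℝ) (f : Cube ι → ℝ) (S : Finset ι) : ℝ :=
  ∫ x, f x * biasedChar μ S x ∂(biasedMeasure μ)

/-- The level-`ℓ` Fourier weight with respect to bias `μ`: the sum of the absolute values of the
biased Fourier coefficients over all sets of size `ℓ`. -/
def levelWeight {ι : Type*} [Fintype ι] (μ : ι → ℝ) (ℓ : ℕ) (f : Cube ι → ℝ) : ℝ :=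
  ∑ S ∈ (Finset.univ : Finset ι).powersetCard ℓ, |biasedCoeff μ f S|

/-! ### The input distributions -/

/-- The `2^n × 2^n` (Sylvester) Hadamard matrix, normalized to be orthogonal: the `(i, j)` entry is
`(-1)^⟨i, j⟩ / √(2^n)`, where `⟨i, j⟩` is the inner product of the binary expansions. -/
def hadamard (n : ℕ) : Matrix (Fin (2 ^ n)) (Fin (2 ^ n)) ℝ :=
  fun i j => (-1) ^ (∑ b : Fin n, (i.val / 2 ^ b.val % 2) * (j.val / 2 ^ b.val % 2)) / √(2 ^ n)

/-- The covariance matrix `Σ` with diagonal blocks `I` and off-diagonal blocks `H`. -/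
def covMat (n : ℕ) : Matrix (Fin (2 ^ n) ⊕ Fin (2 ^ n)) (Fin (2 ^ n) ⊕ Fin (2 ^ n)) ℝ :=
  Matrix.fromBlocks 1 (hadamard n) (hadamard n) 1

/-- The law of `(U_κ, V_κ)_{κ ∈ [k-1]}`: independent Gaussian vectors distributed as `N(0, Σ)`. For
a sample `g`, `U_κ(i) = g κ (Sum.inl i)` and `V_κ(i) = g κ (Sum.inr i)`. -/
def gaussianBlocks (k n : ℕ) :
    Measure (Fin (k - 1) → EuclideanSpace ℝ (Fin (2 ^ n) ⊕ Fin (2 ^ n))) :=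
  Measure.pi fun _ => multivariateGaussian 0 (covMat n)

/-- The truncation function `φ(s) = ∫_0^s γ`, with `γ` the standard Gaussian density. -/
def trunc (s : ℝ) : ℝ := ∫ t in (0 : ℝ)..s, gaussianPDFReal 0 1 t

/-- The block shifted Hadamard product
`x ⋄ y = (x_1, …, x_{k-1}, 𝟏) ⊙ (𝟏, y_1, …, y_{k-1})` of `x` and `y`. -/
def shiftedProd {k N : ℕ} (x y : Fin (k - 1) → Fin N → ℝ) (p : Fin k × Fin N) : ℝ :=
  (if h : p.1.val < k - 1 then x ⟨p.1.val, h⟩ p.2 else 1) *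
    (if h : 0 < p.1.val then y ⟨p.1.val - 1, by omega⟩ p.2 else 1)

/-- The vector of means `W = φ(U) ⋄ φ(V)`. -/
def means {k n : ℕ} (g : Fin (k - 1) → EuclideanSpace ℝ (Fin (2 ^ n) ⊕ Fin (2 ^ n))) :
    Fin k × Fin (2 ^ n) → ℝ :=
  shiftedProd (fun κ i => trunc (g κ (Sum.inl i))) (fun κ i => trunc (g κ (Sum.inr i)))

/-- `p_0`: the uniform distribution on `{±1}^{kN}`, where `N = 2^n`. -/
def p0 (k n : ℕ) : Measure (Cube (Fin k × Fin (2 ^ n))) := uniformOn Set.univ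

/-- `p_1`: sample `(U, V)`, and round the coordinates of `W = φ(U) ⋄ φ(V)` independently to signs
with means `W(i)`. -/
def p1 (k n : ℕ) : Measure (Cube (Fin k × Fin (2 ^ n))) :=
  (gaussianBlocks k n).bind fun g => biasedMeasure (means g)

/-! ### The definitions above are not degenerate: `Σ` is positive semidefinite (hence a covariance
matrix), the truncation maps into `[-1/2, 1/2]`, and `p_1` is a probability measure -/

theorem hadamard_symm (n : ℕ) : (hadamard n).transpose = hadamard n := by
  ext i j
  simp only [Matrix.transpose_apply, hadamard]
  congr 2
  exact Finset.sum_congr rfl fun b _ => mul_comm _ _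

theorem hadamard_mul_self (n : ℕ) : hadamard n * hadamard n = 1 := by
  ext i j
  have key : ∀ a b : Fin (2 ^ n), hadamard n a b
      = (∏ c : Fin n, (-1 : ℝ) ^ ((a.val / 2 ^ c.val % 2) * (finFunctionFinEquiv.symm b c).val))
        / √(2 ^ n) := by
    intro a b
    simp only [hadamard, Finset.prod_pow_eq_pow_sum, finFunctionFinEquiv_symm_apply_val]
  have symm : ∀ a b, hadamard n a b = hadamard n b a := fun a b => by
    conv_lhs => rw [← hadamard_symm]
    rfl
  rw [Matrix.mul_apply]
  have h1 : ∀ b, hadamard n i b * hadamard n b j =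
      (∏ c : Fin n, (-1 : ℝ) ^ ((i.val / 2 ^ c.val % 2 + j.val / 2 ^ c.val % 2)
        * (finFunctionFinEquiv.symm b c).val)) / 2 ^ n := by
    intro b
    rw [symm b j, key, key, div_mul_div_comm, ← Finset.prod_mul_distrib,
      Real.mul_self_sqrt (by positivity)]
    congr 1
    exact Finset.prod_congr rfl fun c _ => by rw [← pow_add, ← add_mul]
  rw [Finset.sum_congr rfl fun b _ => h1 b, ← Finset.sum_div,
    Equiv.sum_comp finFunctionFinEquiv.symm (fun g : Fin n → Fin 2 =>
      ∏ c : Fin n, (-1 : ℝ) ^ ((i.val / 2 ^ c.val % 2 + j.val / 2 ^ c.val % 2) * (g c).val)),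
    ← Fintype.prod_sum (fun (c : Fin n) (e : Fin 2) =>
      (-1 : ℝ) ^ ((i.val / 2 ^ c.val % 2 + j.val / 2 ^ c.val % 2) * e.val))]
  simp only [Fin.sum_univ_two, Fin.val_zero, Fin.val_one, mul_zero, mul_one, pow_zero]
  by_cases hij : i = j
  · subst hij
    have : ∀ c : Fin n, (1 : ℝ) + (-1) ^ (i.val / 2 ^ c.val % 2 + i.val / 2 ^ c.val % 2) = 2 := by
      intro c
      rw [Even.neg_one_pow ⟨_, rfl⟩]
      norm_num
    simp only [this, Finset.prod_const, Finset.card_univ, Fintype.card_fin, Matrix.one_apply_eq]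
    exact div_self (by positivity)
  · rw [Matrix.one_apply_ne hij]
    obtain ⟨c, hc⟩ : ∃ c : Fin n, i.val / 2 ^ c.val % 2 ≠ j.val / 2 ^ c.val % 2 := by
      by_contra! hcon
      apply hij
      apply finFunctionFinEquiv.symm.injective
      funext c
      apply Fin.ext
      simpa [finFunctionFinEquiv_symm_apply_val] using hcon c
    rw [Finset.prod_eq_zero (Finset.mem_univ c), zero_div]
    have : i.val / 2 ^ c.val % 2 + j.val / 2 ^ c.val % 2 = 1 := by omega
    rw [this]
    norm_num

theorem covMat_posSemidef (n : ℕ) : (covMat n).PosSemidef := by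
  have h : covMat n = (Matrix.fromBlocks 1 (hadamard n) 0 0).conjTranspose *
      Matrix.fromBlocks 1 (hadamard n) 0 (0 : Matrix (Fin (2 ^ n)) (Fin (2 ^ n)) ℝ) := by
    rw [Matrix.fromBlocks_conjTranspose, Matrix.fromBlocks_multiply,
      Matrix.conjTranspose_eq_transpose_of_trivial (hadamard n), hadamard_symm]
    simp [covMat, hadamard_mul_self]
  rw [h]
  exact Matrix.posSemidef_conjTranspose_mul_self _

theorem continuous_trunc : Continuous trunc :=
  intervalIntegral.continuous_primitive
    (fun _ _ => (integrable_gaussianPDFReal 0 1).intervalIntegrable) 0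

theorem abs_trunc_le (s : ℝ) : |trunc s| ≤ 1 / 2 := by
  have hint := integrable_gaussianPDFReal 0 1
  have hone := integral_gaussianPDFReal_eq_one 0 (v := 1) one_ne_zero
  have heven : ∀ x, gaussianPDFReal 0 1 (-x) = gaussianPDFReal 0 1 x := by
    intro x; simp [gaussianPDFReal]
  have hneg : ∫ x in Set.Iic (0 : ℝ), gaussianPDFReal 0 1 x =
      ∫ x in Set.Ioi (0 : ℝ), gaussianPDFReal 0 1 x := by
    have := integral_comp_neg_Iic (0 : ℝ) (gaussianPDFReal 0 1)
    simpa [heven] using this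
  have hsum := intervalIntegral.integral_Iic_add_Ioi (b := (0 : ℝ)) (μ := volume)
    hint.integrableOn hint.integrableOn
  have hhalf : ∫ x in Set.Ioi (0 : ℝ), gaussianPDFReal 0 1 x = 1 / 2 := by linarith
  have hpos : ∀ r, 0 ≤ r → |trunc r| ≤ 1 / 2 := by
    intro r hr
    rw [trunc, intervalIntegral.integral_of_le hr,
      abs_of_nonneg (integral_nonneg fun x => gaussianPDFReal_nonneg 0 1 x), ← hhalf]
    exact setIntegral_mono_set hint.integrableOn
      (Filter.Eventually.of_forall fun x => gaussianPDFReal_nonneg 0 1 x)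
      (Filter.Eventually.of_forall fun x hx => hx.1)
  have hodd : trunc (-s) = -trunc s := by
    have := intervalIntegral.integral_comp_neg (a := 0) (b := s) (gaussianPDFReal 0 1)
    simp only [heven, neg_zero] at this
    rw [trunc, trunc, this, intervalIntegral.integral_symm]
  rcases le_total 0 s with h | h
  · exact hpos s h
  · rw [← abs_neg, ← hodd]
    exact hpos (-s) (by linarith)

theorem isProbabilityMeasure_biasedMeasure {ι : Type*} [Fintype ι] {μ : ι → ℝ}
    (hμ : ∀ i, |μ i| ≤ 1) : IsProbabilityMeasure (biasedMeasure μ) := by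
  have h : ∀ i, IsProbabilityMeasure (biasedSign (μ i)) := by
    intro i
    have := abs_le.1 (hμ i)
    constructor
    simp only [biasedSign, Measure.add_apply, Measure.smul_apply, measure_univ, smul_eq_mul,
      mul_one]
    rw [← ENNReal.ofReal_add (by linarith) (by linarith), ← ENNReal.ofReal_one]
    congr 1
    ring
  unfold biasedMeasure
  infer_instance

theorem abs_means_le {k n : ℕ} (hk : 2 ≤ k)
    (g : Fin (k - 1) → EuclideanSpace ℝ (Fin (2 ^ n) ⊕ Fin (2 ^ n))) (p : Fin k × Fin (2 ^ n)) :
    |means g p| ≤ 1 / 2 := by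
  rw [means, shiftedProd, abs_mul]
  split_ifs with h1 h2 h2
  · have ha := abs_trunc_le (g ⟨p.1.val, h1⟩ (Sum.inl p.2))
    have hb := abs_trunc_le (g ⟨p.1.val - 1, by omega⟩ (Sum.inr p.2))
    nlinarith [abs_nonneg (trunc (g ⟨p.1.val, h1⟩ (Sum.inl p.2))),
      abs_nonneg (trunc (g ⟨p.1.val - 1, by omega⟩ (Sum.inr p.2)))]
  · simpa using abs_trunc_le (g ⟨p.1.val, h1⟩ (Sum.inl p.2))
  · simpa using abs_trunc_le (g ⟨p.1.val - 1, by omega⟩ (Sum.inr p.2))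
  · omega

theorem measurable_biasedMeasure {ι : Type*} [Fintype ι] :
    Measurable (biasedMeasure : (ι → ℝ) → Measure (Cube ι)) := by
  classical
  have hfin : ∀ m, IsFiniteMeasure (biasedSign m) := by
    intro m
    constructor
    simp [biasedSign]
  refine Measure.measurable_of_measurable_coe _ fun s _ => ?_
  have h : ∀ μ : ι → ℝ, biasedMeasure μ s =
      ∑ z ∈ s.toFinite.toFinset, ∏ i, biasedSign (μ i) {z i} := by
    intro μ
    have h1 := sum_measure_singleton (μ := biasedMeasure μ) (s := s.toFinite.toFinset)
    rw [Set.Finite.coe_toFinset] at h1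
    rw [← h1]
    exact Finset.sum_congr rfl fun z _ => Measure.pi_singleton _ z
  simp only [h]
  refine Finset.measurable_sum _ fun z _ => Finset.measurable_prod _ fun i _ => ?_
  simp only [biasedSign, Measure.add_apply, Measure.smul_apply, smul_eq_mul]
  fun_prop

theorem measurable_means {k n : ℕ} : Measurable (means (k := k) (n := n)) := by
  refine measurable_pi_lambda _ fun p => ?_
  unfold means shiftedProd
  have := continuous_trunc.measurable
  split_ifs <;> fun_prop

theorem isProbabilityMeasure_p1 {k : ℕ} (hk : 2 ≤ k) (n : ℕ) : IsProbabilityMeasure (p1 k n) := by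
  have h : IsProbabilityMeasure (gaussianBlocks k n) := by
    unfold gaussianBlocks
    infer_instance
  exact isProbabilityMeasure_bind
    (measurable_biasedMeasure.comp measurable_means).aemeasurable
    (Filter.Eventually.of_forall fun g => isProbabilityMeasure_biasedMeasure fun p =>
      (abs_means_le hk g p).trans (by norm_num))

end

end Forrelation

/-! The level `ℓ = k` summand alone dominates the difference. Conditionally on the Gaussians, the
mean of `f` is the value at `W` of its multilinear extension. Its derivatives `∂_T f` at a point of
`[-1/2, 1/2]^{kN}` are the biased Fourier coefficients there, up to a factor at most `2` per element
of `T`. With `N = 2^n`, it therefore suffices to bound the difference by `N^{-(k-1)/2}` times the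
supremum of `∑_{|T| = k} |∂_T f|` (`abs_integral_sub_le`).

Since `H` is symmetric and orthogonal, `V_κ = H U_κ`, so everything is a function of independent
standard Gaussian vectors `U_κ`. Scale the first block of `W` by `r ∈ [0, 1]`. At `r = 1` this is
`p_1`. At `r = 0` the vector `U_1` survives only through `V_1`, which makes the second block
centered with independent coordinates given the rest. Multilinearity then replaces that block by
zero, which frees the next one, and so on down to the uniform law (`integral_mlDeriv_zero_blocks`).

The `r`-derivative is `∑_j E[φ(U_1(j)) ∂_{(1,j)} f]`. Gaussian integration by parts in the form
`E[φ(x) g(x)] = E[ψ(x) g'(x)]`, with `0 ≤ ψ ≤ 1`, trades the factor `φ(U_1(j))` for a derivative in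
`U_1(j)`. As `∂_{(1,j)} f` ignores coordinate `(1,j)`, that derivative acts only through `V_1` in
the second block. It yields a sum over `i` of `H i j`, bounded factors, a new factor `φ(U_2(i))` and
a further derivative at `(2,i)`. Iterating through the blocks (`abs_integral_path_le`) produces `k -
1` Hadamard entries, each of size `N^{-1/2}`, and a set with one point in each block. Distinct paths
give distinct `k`-sets, so the path sum is at most the sum over all `k`-sets, with no combinatorial
loss. -/

namespace Forrelation

noncomputable section

/-! ### The multilinear extension of a function on the cube and its partial derivatives -/

/-- The partial derivative `∂_S f` of the multilinear extension of `f : {±1}^ι → ℝ` at `w`. -/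
def mlDeriv {ι : Type*} [Fintype ι] [DecidableEq ι] (f : Cube ι → ℝ) (S : Finset ι)
    (w : ι → ℝ) : ℝ :=
  ∑ z : Cube ι, f z * ∏ p, if p ∈ S then ((z p : ℤ) : ℝ) / 2 else (1 + w p * ((z p : ℤ) : ℝ)) / 2

section

variable {ι : Type*} [Fintype ι]

theorem isProbabilityMeasure_biasedSign {m : ℝ} (hm : |m| ≤ 1) :
    IsProbabilityMeasure (biasedSign m) := by
  have := abs_le.1 hm
  constructor
  simp only [biasedSign, Measure.add_apply, Measure.smul_apply, measure_univ, smul_eq_mul, mul_one]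
  rw [← ENNReal.ofReal_add (by linarith) (by linarith), ← ENNReal.ofReal_one]
  congr 1
  ring

theorem biasedSign_real_singleton {m : ℝ} (hm : |m| ≤ 1) (s : ℤˣ) :
    (biasedSign m).real {s} = (1 + m * ((s : ℤ) : ℝ)) / 2 := by
  have := abs_le.1 hm
  rcases Int.units_eq_one_or s with rfl | rfl
  · have : (-1 : ℤˣ) ∉ ({1} : Set ℤˣ) := by decide
    simp [biasedSign, Measure.real, this]
    linarith
  · have : (1 : ℤˣ) ∉ ({-1} : Set ℤˣ) := by decide
    simp only [biasedSign, Measure.real, Measure.add_apply, Measure.smul_apply, smul_eq_mul,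
      Measure.dirac_apply' _ (measurableSet_singleton _), Set.indicator, this, if_false]
    simp only [Set.mem_singleton_iff, if_true, mul_zero, zero_add, Pi.one_apply, mul_one,
      Units.val_neg, Units.val_one, Int.cast_neg, Int.cast_one]
    rw [ENNReal.toReal_ofReal (by linarith)]
    ring

theorem biasedMeasure_real_singleton {μ : ι → ℝ} (hμ : ∀ i, |μ i| ≤ 1) (z : Cube ι) :
    (biasedMeasure μ).real {z} = ∏ i, (1 + μ i * ((z i : ℤ) : ℝ)) / 2 := by
  have : ∀ i, IsProbabilityMeasure (biasedSign (μ i)) := fun i =>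
    isProbabilityMeasure_biasedSign (hμ i)
  rw [biasedMeasure, Measure.real, Measure.pi_singleton, ENNReal.toReal_prod]
  exact Finset.prod_congr rfl fun i _ => biasedSign_real_singleton (hμ i) (z i)

theorem levelWeight_nonneg (μ : ι → ℝ) (ℓ : ℕ) (f : Cube ι → ℝ) : 0 ≤ levelWeight μ ℓ f :=
  Finset.sum_nonneg fun _ _ => abs_nonneg _

variable [DecidableEq ι]

theorem continuous_mlDeriv (f : Cube ι → ℝ) (S : Finset ι) : Continuous (mlDeriv f S) := by
  unfold mlDeriv
  refine continuous_finsetSum _ fun z _ => continuous_const.mul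
    (continuous_finsetProd _ fun p _ => ?_)
  split_ifs <;> fun_prop

/-- Chain rule for a multilinear function. Coordinates in `S` have already been differentiated away,
so nothing is asked of `w` there; this is what later removes the dependence on the point just
visited. -/
theorem hasDerivAt_mlDeriv (f : Cube ι → ℝ) (S : Finset ι) {w : ℝ → ι → ℝ} {w' : ι → ℝ} {x : ℝ}
    (hw : ∀ p ∉ S, HasDerivAt (fun y => w y p) (w' p) x) :
    HasDerivAt (fun y => mlDeriv f S (w y))
      (∑ p ∈ Sᶜ, w' p * mlDeriv f (insert p S) (w x)) x := by
  have h1 : ∀ z : Cube ι, HasDerivAt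
      (fun y => f z * ∏ p, if p ∈ S then ((z p : ℤ) : ℝ) / 2
        else (1 + w y p * ((z p : ℤ) : ℝ)) / 2)
      (f z * ∑ p, (∏ q ∈ Finset.univ.erase p, if q ∈ S then ((z q : ℤ) : ℝ) / 2
        else (1 + w x q * ((z q : ℤ) : ℝ)) / 2) •
          (if p ∈ S then 0 else w' p * ((z p : ℤ) : ℝ) / 2)) x := by
    intro z
    refine HasDerivAt.const_mul _ (HasDerivAt.fun_finsetProd fun p _ => ?_)
    by_cases hp : p ∈ S
    · simpa [hp] using hasDerivAt_const x (((z p : ℤ) : ℝ) / 2)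
    · simpa [hp] using (((hw p hp).mul_const ((z p : ℤ) : ℝ)).const_add 1).div_const 2
  have h2 := HasDerivAt.fun_sum (u := Finset.univ) fun z _ => h1 z
  refine h2.congr_deriv ?_
  simp only [mlDeriv, Finset.mul_sum]
  rw [Finset.sum_comm, ← Finset.sum_compl_add_sum S]
  have hS : ∀ p ∈ S, ∑ z : Cube ι, f z * ((∏ q ∈ Finset.univ.erase p,
      if q ∈ S then ((z q : ℤ) : ℝ) / 2 else (1 + w x q * ((z q : ℤ) : ℝ)) / 2) •
          (if p ∈ S then 0 else w' p * ((z p : ℤ) : ℝ) / 2)) = 0 := fun p hp => by simp [hp]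
  rw [Finset.sum_eq_zero hS, add_zero]
  refine Finset.sum_congr rfl fun p hp => Finset.sum_congr rfl fun z _ => ?_
  have hp' : p ∉ S := by simpa using hp
  rw [← Finset.mul_prod_erase _ _ (Finset.mem_univ p)]
  have : ∀ q ∈ Finset.univ.erase p,
      (if q ∈ insert p S then ((z q : ℤ) : ℝ) / 2 else (1 + w x q * ((z q : ℤ) : ℝ)) / 2) =
      if q ∈ S then ((z q : ℤ) : ℝ) / 2 else (1 + w x q * ((z q : ℤ) : ℝ)) / 2 := by
    intro q hq
    simp [Finset.ne_of_mem_erase hq]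
  rw [Finset.prod_congr rfl this]
  simp only [hp', Finset.mem_insert_self, if_true, if_false, smul_eq_mul]
  ring

/-! ### Biased Fourier coefficients as derivatives of the multilinear extension -/

theorem integral_biasedMeasure {μ : ι → ℝ} (hμ : ∀ i, |μ i| ≤ 1) (g : Cube ι → ℝ) :
    ∫ z, g z ∂(biasedMeasure μ) = ∑ z, g z * ∏ i, (1 + μ i * ((z i : ℤ) : ℝ)) / 2 := by
  have := isProbabilityMeasure_biasedMeasure hμ
  rw [integral_fintype Integrable.of_finite]
  exact Finset.sum_congr rfl fun z _ => by
    rw [biasedMeasure_real_singleton hμ, smul_eq_mul, mul_comm]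

/-- Coordinatewise this is `(1 + m z)(z - m) = (1 - m²) z`, valid because `z² = 1`. -/
theorem biasedCoeff_eq_mlDeriv {μ : ι → ℝ} (hμ : ∀ i, |μ i| < 1) (f : Cube ι → ℝ)
    (S : Finset ι) :
    biasedCoeff μ f S = (∏ i ∈ S, √(1 - μ i ^ 2)) * mlDeriv f S μ := by
  rw [biasedCoeff, integral_biasedMeasure fun i => (hμ i).le, mlDeriv, Finset.mul_sum]
  refine Finset.sum_congr rfl fun z _ => ?_
  rw [biasedChar, mul_assoc, mul_left_comm (∏ i ∈ S, √(1 - μ i ^ 2))]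
  congr 1
  have hext : ∀ g : ι → ℝ, ∏ i ∈ S, g i = ∏ i, if i ∈ S then g i else 1 := fun g => by
    rw [Finset.prod_ite_mem, Finset.univ_inter]
  rw [hext, hext, ← Finset.prod_mul_distrib, ← Finset.prod_mul_distrib]
  refine Finset.prod_congr rfl fun i _ => ?_
  by_cases hi : i ∈ S
  · have hpos : 0 < 1 - μ i ^ 2 := by
      have := (sq_lt_one_iff_abs_lt_one (μ i)).2 (hμ i)
      linarith
    have hz : (((z i : ℤ) : ℝ)) ^ 2 = 1 := by
      rcases Int.units_eq_one_or (z i) with h | h <;> simp [h]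
    have hs := Real.sq_sqrt hpos.le
    have hs0 := Real.sqrt_pos.2 hpos
    simp only [hi, if_true]
    field_simp
    rw [hs]
    linear_combination μ i * hz
  · simp [hi]

/-- For biases at most `1/2` each normalizing factor `√(1 - μ_i²)` is at least `1/2`. -/
theorem abs_mlDeriv_le {μ : ι → ℝ} (hμ : ∀ i, |μ i| ≤ 1 / 2) (f : Cube ι → ℝ) (S : Finset ι) :
    |mlDeriv f S μ| ≤ 2 ^ S.card * |biasedCoeff μ f S| := by
  have h1 : ∀ i, 1 ≤ 2 * √(1 - μ i ^ 2) := by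
    intro i
    have h2 : (1 / 2 : ℝ) ≤ √(1 - μ i ^ 2) := by
      apply Real.le_sqrt_of_sq_le
      have := abs_le.1 (hμ i)
      nlinarith
    linarith
  rw [biasedCoeff_eq_mlDeriv (fun i => (hμ i).trans_lt (by norm_num)), abs_mul,
    Finset.abs_prod, ← Finset.prod_const, ← mul_assoc, ← Finset.prod_mul_distrib]
  refine le_mul_of_one_le_left (abs_nonneg _) ?_
  refine Finset.prod_const_one.symm.trans_le (Finset.prod_le_prod (fun _ _ => zero_le_one) fun i _ => ?_)
  rw [abs_of_nonneg (Real.sqrt_nonneg _)]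
  exact h1 i

/-- A crude uniform bound for `∂_S f`. -/
theorem exists_abs_mlDeriv_le (f : Cube ι → ℝ) : ∃ C, ∀ (S : Finset ι) (w : ι → ℝ),
    (∀ i, |w i| ≤ 1) → |mlDeriv f S w| ≤ C := by
  refine ⟨∑ z : Cube ι, |f z|, fun S w hw => ?_⟩
  refine (Finset.abs_sum_le_sum_abs _ _).trans (Finset.sum_le_sum fun z _ => ?_)
  rw [abs_mul, Finset.abs_prod]
  refine mul_le_of_le_one_right (abs_nonneg _) (Finset.prod_le_one (fun _ _ => abs_nonneg _) ?_)
  intro p _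
  have := abs_le.1 (hw p)
  rcases Int.units_eq_one_or (z p) with h | h <;> split_ifs <;> rw [abs_le] <;>
    constructor <;> simp [h] <;> linarith

/-- Supplies the finiteness of the supremum, without which `⨆` in `ℝ` would carry no information. -/
theorem exists_levelWeight_le (f : Cube ι → ℝ) (ℓ : ℕ) : ∃ C, ∀ μ : ι → ℝ,
    (∀ i, |μ i| ≤ 1 / 2) → levelWeight μ ℓ f ≤ C := by
  obtain ⟨C, hC⟩ := exists_abs_mlDeriv_le f
  refine ⟨∑ S ∈ (Finset.univ : Finset ι).powersetCard ℓ, C, fun μ hμ => ?_⟩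
  refine Finset.sum_le_sum fun S _ => ?_
  rw [biasedCoeff_eq_mlDeriv (fun i => (hμ i).trans_lt (by norm_num)), abs_mul, Finset.abs_prod]
  refine (mul_le_of_le_one_left (abs_nonneg _) (Finset.prod_le_one (fun _ _ => abs_nonneg _)
    fun i _ => ?_)).trans (hC S μ fun i => (hμ i).trans (by norm_num))
  rw [abs_of_nonneg (Real.sqrt_nonneg _), Real.sqrt_le_iff]
  exact ⟨zero_le_one, by nlinarith [sq_nonneg (μ i)]⟩

theorem integral_uniformOn_univ_eq_mlDeriv (f : Cube ι → ℝ) :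
    ∫ z, f z ∂(uniformOn (Set.univ : Set (Cube ι))) = mlDeriv f ∅ 0 := by
  have := isProbabilityMeasure_uniformOn (Ω := Cube ι) Set.finite_univ Set.univ_nonempty
  rw [integral_fintype Integrable.of_finite, mlDeriv]
  refine Finset.sum_congr rfl fun z _ => ?_
  rw [smul_eq_mul, mul_comm, Measure.real, uniformOn_univ]
  simp [Fintype.card_pi, div_eq_mul_inv]

/-- Given `W`, the signs are independent, so the conditional mean of `f` is its multilinear
extension at `W`. -/
theorem integral_bind_biasedMeasure {Ω : Type*} [MeasurableSpace Ω] (P : Measure Ω)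
    [IsProbabilityMeasure P] {W : Ω → ι → ℝ} (hW : Measurable W) (hb : ∀ ω i, |W ω i| ≤ 1)
    (f : Cube ι → ℝ) :
    ∫ z, f z ∂(P.bind fun ω => biasedMeasure (W ω)) = ∫ ω, mlDeriv f ∅ (W ω) ∂P := by
  have hm : Measurable fun ω => biasedMeasure (W ω) := measurable_biasedMeasure.comp hW
  have hp : ∀ ω, IsProbabilityMeasure (biasedMeasure (W ω)) := fun ω =>
    isProbabilityMeasure_biasedMeasure (hb ω)
  have := isProbabilityMeasure_bind hm.aemeasurable (Filter.Eventually.of_forall (f := ae P) hp)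
  have hint : ∀ z, Integrable (fun ω => (biasedMeasure (W ω)).real {z}) P := fun z =>
    Integrable.of_bound (((Measure.measurable_coe (measurableSet_singleton z)).comp
      hm).ennreal_toReal.aestronglyMeasurable) 1 (Filter.Eventually.of_forall fun ω => by
        have := hp ω
        rw [Real.norm_eq_abs, abs_of_nonneg measureReal_nonneg]
        exact measureReal_le_one)
  rw [integral_fintype Integrable.of_finite]
  have h2 : ∀ ω, mlDeriv f ∅ (W ω) = ∑ z, f z * (biasedMeasure (W ω)).real {z} := by
    intro ω
    simp [mlDeriv, biasedMeasure_real_singleton (hb ω)]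
  simp only [h2]
  rw [integral_finsetSum _ fun z _ => (hint z).const_mul _]
  refine Finset.sum_congr rfl fun z _ => ?_
  rw [integral_const_mul, smul_eq_mul, mul_comm]
  congr 1
  rw [Measure.real, Measure.bind_apply (measurableSet_singleton z) hm.aemeasurable]
  simp only [Measure.real]
  rw [integral_toReal]
  · exact ((Measure.measurable_coe (measurableSet_singleton z)).comp hm).aemeasurable
  · exact Filter.Eventually.of_forall fun ω => by
      have := hp ω
      exact measure_lt_top _ _

end

/-! ### Gaussian integration by parts against the truncation -/

theorem continuous_gaussianPDFReal : Continuous (gaussianPDFReal 0 1) := by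
  unfold gaussianPDFReal
  fun_prop

theorem gaussianPDFReal_pos' (x : ℝ) : 0 < gaussianPDFReal 0 1 x :=
  gaussianPDFReal_pos 0 1 x one_ne_zero

theorem gaussianPDFReal_le_one (x : ℝ) : gaussianPDFReal 0 1 x ≤ 1 := by
  unfold gaussianPDFReal
  refine mul_le_one₀ (inv_le_one_of_one_le₀ ?_) (Real.exp_nonneg _) ?_
  · rw [Real.one_le_sqrt]
    have := Real.pi_gt_three
    simp only [NNReal.coe_one]
    linarith
  · rw [Real.exp_le_one_iff]
    simp only [sub_zero, NNReal.coe_one, mul_one]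
    nlinarith [sq_nonneg x]

theorem hasDerivAt_gaussianPDFReal (x : ℝ) :
    HasDerivAt (gaussianPDFReal 0 1) (-x * gaussianPDFReal 0 1 x) x := by
  have h : HasDerivAt (fun y : ℝ => -(y - 0) ^ 2 / (2 * ((1 : NNReal) : ℝ))) (-x) x := by
    have := ((((hasDerivAt_id x).sub_const 0).pow 2).neg).div_const (2 * ((1 : NNReal) : ℝ))
    refine this.congr_deriv ?_
    simp
    ring
  have := (h.exp).const_mul (√(2 * Real.pi * ((1 : NNReal) : ℝ)))⁻¹
  refine this.congr_deriv ?_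
  unfold gaussianPDFReal
  ring

theorem hasDerivAt_trunc (x : ℝ) : HasDerivAt trunc (gaussianPDFReal 0 1 x) x :=
  intervalIntegral.integral_hasDerivAt_right
    ((integrable_gaussianPDFReal 0 1).intervalIntegrable)
    (continuous_gaussianPDFReal.stronglyMeasurable.stronglyMeasurableAtFilter)
    continuous_gaussianPDFReal.continuousAt

theorem trunc_neg (s : ℝ) : trunc (-s) = -trunc s := by
  have heven : ∀ x, gaussianPDFReal 0 1 (-x) = gaussianPDFReal 0 1 x := by
    intro x; simp [gaussianPDFReal]
  have := intervalIntegral.integral_comp_neg (a := 0) (b := s) (gaussianPDFReal 0 1)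
  simp only [heven, neg_zero] at this
  rw [trunc, trunc, this, intervalIntegral.integral_symm]

theorem tendsto_trunc_atTop : Filter.Tendsto trunc Filter.atTop (nhds (1 / 2)) := by
  have hint := integrable_gaussianPDFReal 0 1
  have h1 := intervalIntegral_tendsto_integral (a := fun s : ℝ => -s) (b := id) hint
    Filter.tendsto_neg_atTop_atBot Filter.tendsto_id
  rw [integral_gaussianPDFReal_eq_one 0 (v := 1) one_ne_zero] at h1
  refine (h1.div_const 2).congr fun s => ?_
  have h2 := intervalIntegral.integral_add_adjacent_intervals (μ := volume)
    (hint.intervalIntegrable (a := -s) (b := 0)) (hint.intervalIntegrable (a := 0) (b := s))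
  have h3 : ∫ x in (-s)..0, gaussianPDFReal 0 1 x = trunc s := by
    rw [intervalIntegral.integral_symm, ← neg_neg (trunc s), ← trunc_neg]
    rfl
  rw [h3] at h2
  rw [id, ← h2]
  simp only [trunc]
  ring

/-- The function `ψ = (1/4 - φ²) / (2 φ')`, which solves Stein's equation `x ψ - ψ' = φ`. -/
def steinSol (x : ℝ) : ℝ := (1 / 4 - trunc x ^ 2) / 2 / gaussianPDFReal 0 1 x

theorem steinSol_mul_pdf (x : ℝ) :
    gaussianPDFReal 0 1 x * steinSol x = (1 / 4 - trunc x ^ 2) / 2 :=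
  mul_div_cancel₀ _ (gaussianPDFReal_pos' x).ne'

theorem continuous_steinSol : Continuous steinSol := by
  unfold steinSol
  exact ((continuous_const.sub (continuous_trunc.pow 2)).div_const 2).div
    continuous_gaussianPDFReal fun x => (gaussianPDFReal_pos' x).ne'

/-- This is the bound `ψ ≤ 1`. Both sides are even. On `[0, ∞)` their difference has derivative `γ
(φ - x) ≤ 0`, since `γ ≤ 1` gives `φ(x) ≤ x`; a decreasing function is bounded below by its limit.
-/
theorem quarter_sub_trunc_sq_le (x : ℝ) : (1 / 4 - trunc x ^ 2) / 2 ≤ gaussianPDFReal 0 1 x := by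
  wlog hx : 0 ≤ x generalizing x
  · have := this (-x) (by linarith)
    simpa [trunc_neg, gaussianPDFReal] using this
  set F : ℝ → ℝ := fun y => gaussianPDFReal 0 1 y - (1 / 4 - trunc y ^ 2) / 2 with hF
  have hd : ∀ y, HasDerivAt F (gaussianPDFReal 0 1 y * (trunc y - y)) y := fun y => by
    have := (hasDerivAt_gaussianPDFReal y).sub
      ((((hasDerivAt_trunc y).pow 2).const_sub (1 / 4)).div_const 2)
    refine this.congr_deriv ?_
    simp
    ring
  have htr : ∀ y, 0 ≤ y → trunc y ≤ y := fun y hy => by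
    have := intervalIntegral.integral_mono_on (μ := volume) hy
      ((integrable_gaussianPDFReal 0 1).intervalIntegrable) (intervalIntegrable_const (c := (1 : ℝ)))
      fun t _ => gaussianPDFReal_le_one t
    simpa [trunc] using this
  have hanti : AntitoneOn F (Set.Ici 0) := by
    refine antitoneOn_of_deriv_nonpos (convex_Ici 0)
      (fun y _ => (hd y).continuousAt.continuousWithinAt)
      (fun y _ => (hd y).differentiableAt.differentiableWithinAt) fun y hy => ?_
    rw [interior_Ici, Set.mem_Ioi] at hy
    rw [(hd y).deriv]
    exact mul_nonpos_of_nonneg_of_nonpos (gaussianPDFReal_pos' y).le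
      (sub_nonpos.2 (htr y hy.le))
  -- Dropping the positive term `γ` from `F` gives a minorant that already tends to `0`, so the
  -- decay of `γ` is not needed.
  have hlim : Filter.Tendsto (fun y => -((1 / 4 - trunc y ^ 2) / 2)) Filter.atTop (nhds 0) := by
    have := (((tendsto_trunc_atTop.pow 2).const_sub (1 / 4)).div_const 2).neg
    norm_num at this
    simpa using this
  have h0 : 0 ≤ F x := by
    refine le_of_tendsto hlim (Filter.eventually_atTop.2 ⟨x, fun y hy => ?_⟩)
    refine le_trans ?_ (hanti hx (hx.trans hy) hy)
    simp only [hF]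
    linarith [gaussianPDFReal_pos' y]
  simp only [hF] at h0
  linarith

theorem trunc_sq_le (x : ℝ) : trunc x ^ 2 ≤ 1 / 4 := by
  have := abs_le.1 (abs_trunc_le x)
  nlinarith

theorem abs_steinSol_le (x : ℝ) : |steinSol x| ≤ 1 := by
  have h := trunc_sq_le x
  rw [steinSol, abs_of_nonneg (div_nonneg (by linarith) (gaussianPDFReal_pos' x).le)]
  exact div_le_one_of_le₀ (quarter_sub_trunc_sq_le x) (gaussianPDFReal_pos' x).le

/-- Integration by parts on the line with `u = γ ψ = (1/4 - φ²)/2`, for which `u' = -φ γ`. Both `u`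
and `u'` are dominated by `γ`, which settles integrability. -/
theorem integral_trunc_mul_gaussianReal {g g' : ℝ → ℝ} {C : ℝ} (hg : ∀ x, HasDerivAt g (g' x) x)
    (hg' : Continuous g') (hC : ∀ x, |g x| ≤ C) (hC' : ∀ x, |g' x| ≤ C) :
    ∫ x, trunc x * g x ∂(gaussianReal 0 1) = ∫ x, steinSol x * g' x ∂(gaussianReal 0 1) := by
  have hgc : Continuous g := continuous_iff_continuousAt.2 fun x => (hg x).continuousAt
  have hint := integrable_gaussianPDFReal 0 1
  have hu : ∀ x, HasDerivAt (fun x => (1 / 4 - trunc x ^ 2) / 2)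
      (-(trunc x * gaussianPDFReal 0 1 x)) x := fun x => by
    refine ((((hasDerivAt_trunc x).pow 2).const_sub (1 / 4)).div_const 2).congr_deriv ?_
    simp
    ring
  have hdom : ∀ {w h : ℝ → ℝ}, Continuous w → Continuous h →
      (∀ x, |w x| ≤ gaussianPDFReal 0 1 x) → (∀ x, |h x| ≤ C) →
      Integrable (w * h) := fun {w h} hw hh hb hb' => by
    refine (hint.mul_const C).mono' (hw.mul hh).aestronglyMeasurable
      (Filter.Eventually.of_forall fun x => ?_)
    simp only [Pi.mul_apply, norm_mul, Real.norm_eq_abs]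
    exact mul_le_mul (hb x) (hb' x) (abs_nonneg _) (gaussianPDFReal_pos' x).le
  have hcu : Continuous fun x => (1 / 4 - trunc x ^ 2) / 2 :=
    (continuous_const.sub (continuous_trunc.pow 2)).div_const 2
  have hbu : ∀ x, |(1 / 4 - trunc x ^ 2) / 2| ≤ gaussianPDFReal 0 1 x := fun x => by
    rw [abs_of_nonneg (by linarith [trunc_sq_le x])]
    exact quarter_sub_trunc_sq_le x
  have hbu' : ∀ x, |-(trunc x * gaussianPDFReal 0 1 x)| ≤ gaussianPDFReal 0 1 x := fun x => by
    rw [abs_neg, abs_mul, abs_of_pos (gaussianPDFReal_pos' x)]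
    exact mul_le_of_le_one_left (gaussianPDFReal_pos' x).le
      ((abs_trunc_le x).trans (by norm_num))
  have key := integral_mul_deriv_eq_deriv_mul_of_integrable
    (u := fun x => (1 / 4 - trunc x ^ 2) / 2) (fun x _ => hu x) (fun x _ => hg x)
    (hdom hcu hg' hbu hC')
    (hdom (continuous_trunc.mul continuous_gaussianPDFReal).neg hgc hbu' hC)
    (hdom hcu hgc hbu hC)
  rw [integral_gaussianReal_eq_integral_smul one_ne_zero,
    integral_gaussianReal_eq_integral_smul one_ne_zero]
  simp only [smul_eq_mul, ← mul_assoc, steinSol_mul_pdf]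
  rw [key, ← integral_neg]
  congr 1
  ext x
  ring

theorem integral_trunc_gaussianReal : ∫ x, trunc x ∂(gaussianReal 0 1) = 0 := by
  have := integral_trunc_mul_gaussianReal (g := fun _ => 1) (g' := fun _ => 0) (C := 1)
    (fun x => hasDerivAt_const x 1) continuous_const (by simp) (by simp)
  simpa using this

/-! ### Resampling one coordinate of a product measure -/

/-- Fubini in one coordinate, phrased as resampling so that the index type is never split. It is
checked on boxes: the preimage of a box frees side `j` and constrains the fresh sample instead. -/
theorem measurePreserving_update {ι : Type*} [Fintype ι] [DecidableEq ι] {X : ι → Type*}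
    [∀ i, MeasurableSpace (X i)] (μ : ∀ i, Measure (X i)) [∀ i, IsProbabilityMeasure (μ i)]
    (j : ι) :
    MeasurePreserving (fun q : (∀ i, X i) × X j => Function.update q.1 j q.2)
      ((Measure.pi μ).prod (μ j)) (Measure.pi μ) := by
  have hm : Measurable fun q : (∀ i, X i) × X j => Function.update q.1 j q.2 := by
    refine measurable_pi_lambda _ fun i => ?_
    by_cases h : i = j
    · subst h
      simpa using measurable_snd
    · simp only [Function.update_of_ne h]
      exact (measurable_pi_apply i).comp measurable_fst
  refine ⟨hm, (Measure.pi_eq fun s hs => ?_).symm⟩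
  rw [Measure.map_apply hm (MeasurableSet.univ_pi hs)]
  have : (fun q : (∀ i, X i) × X j => Function.update q.1 j q.2) ⁻¹' (Set.univ.pi s) =
      (Set.univ.pi (Function.update s j Set.univ)) ×ˢ s j := by
    ext q
    simp only [Set.mem_preimage, Set.mem_univ_pi, Set.mem_prod]
    constructor
    · intro h
      refine ⟨fun i => ?_, by simpa using h j⟩
      by_cases hi : i = j
      · subst hi; simp
      · simpa [Function.update_of_ne hi] using h i
    · rintro ⟨h1, h2⟩ i
      by_cases hi : i = j
      · subst hi; simpa using h2
      · simpa [Function.update_of_ne hi] using h1 i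
  rw [this, Measure.prod_prod, Measure.pi_pi, ← Finset.mul_prod_erase _ _ (Finset.mem_univ j),
    ← Finset.mul_prod_erase _ _ (Finset.mem_univ j)]
  simp only [Function.update_self, measure_univ, one_mul]
  rw [mul_comm]
  congr 1
  exact Finset.prod_congr rfl fun i hi => by
    rw [Function.update_of_ne (Finset.ne_of_mem_erase hi)]

theorem integral_pi_eq_integral_update {ι : Type*} [Fintype ι] [DecidableEq ι] {X : ι → Type*}
    [∀ i, MeasurableSpace (X i)] (μ : ∀ i, Measure (X i)) [∀ i, IsProbabilityMeasure (μ i)]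
    (j : ι) {F : (∀ i, X i) → ℝ} (hF : Integrable F (Measure.pi μ)) :
    ∫ u, F u ∂(Measure.pi μ) = ∫ u, ∫ x, F (Function.update u j x) ∂(μ j) ∂(Measure.pi μ) := by
  have h := measurePreserving_update μ j
  conv_lhs => rw [← h.map_eq]
  rw [integral_map h.measurable.aemeasurable (by rw [h.map_eq]; exact hF.aestronglyMeasurable),
    integral_prod (fun q : (∀ i, X i) × X j => F (Function.update q.1 j q.2))
      (h.integrable_comp_of_integrable hF)]

theorem integrable_of_continuous_of_abs_le {Ω : Type*} [TopologicalSpace Ω] [MeasurableSpace Ω]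
    [OpensMeasurableSpace Ω] {P : Measure Ω} [IsFiniteMeasure P] {F : Ω → ℝ} {C : ℝ}
    (hF : Continuous F) (hC : ∀ ω, |F ω| ≤ C) : Integrable F P :=
  Integrable.of_bound hF.aestronglyMeasurable C (Filter.Eventually.of_forall hC)

/-! ### The Gaussian vectors `(U, V) = (U, H U)` -/

/-- The standard Gaussian measure on `ℝ^N`. -/
def stdBlock (N : ℕ) : Measure (Fin N → ℝ) := Measure.pi fun _ => gaussianReal 0 1

instance (N : ℕ) : IsProbabilityMeasure (stdBlock N) := by
  unfold stdBlock
  infer_instance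

/-- The law of `m` independent standard Gaussian vectors in `ℝ^N`. -/
def stdBlocks (m N : ℕ) : Measure (Fin m → Fin N → ℝ) := Measure.pi fun _ => stdBlock N

instance (m N : ℕ) : IsProbabilityMeasure (stdBlocks m N) := by
  unfold stdBlocks
  infer_instance

/-- The one-dimensional identity with all other coordinates frozen. Asking for the derivative only
at the current value `u κ j` is enough, because `u` is arbitrary and may itself be the updated
point. -/
theorem integral_trunc_mul_stdBlocks {m N : ℕ} (κ : Fin m) (j : Fin N)
    {G G' : (Fin m → Fin N → ℝ) → ℝ} {C : ℝ} (hGc : Continuous G) (hGc' : Continuous G')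
    (hG : ∀ u, HasDerivAt (fun y => G (Function.update u κ (Function.update (u κ) j y)))
      (G' u) (u κ j)) (hC : ∀ u, |G u| ≤ C) (hC' : ∀ u, |G' u| ≤ C) :
    ∫ u, trunc (u κ j) * G u ∂(stdBlocks m N) =
      ∫ u, steinSol (u κ j) * G' u ∂(stdBlocks m N) := by
  have hupd : ∀ (F : (Fin m → Fin N → ℝ) → ℝ), Continuous F → (∀ u, |F u| ≤ C) →
      ∫ u, F u ∂(stdBlocks m N) = ∫ u, ∫ a, ∫ x,
        F (Function.update u κ (Function.update a j x)) ∂(gaussianReal 0 1) ∂(stdBlock N)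
          ∂(stdBlocks m N) := by
    intro F hF hb
    rw [stdBlocks, integral_pi_eq_integral_update _ κ (integrable_of_continuous_of_abs_le hF hb)]
    congr 1
    ext u
    have hc : Continuous fun a : Fin N → ℝ => F (Function.update u κ a) :=
      hF.comp (continuous_const.update κ continuous_id)
    rw [stdBlock, integral_pi_eq_integral_update _ j
      (integrable_of_continuous_of_abs_le hc fun a => hb _)]
  have hb1 : ∀ u : Fin m → Fin N → ℝ, |trunc (u κ j) * G u| ≤ C := fun u => by
    rw [abs_mul]
    exact (mul_le_of_le_one_left (abs_nonneg _) ((abs_trunc_le _).trans (by norm_num))).trans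
      (hC u)
  have hb2 : ∀ u : Fin m → Fin N → ℝ, |steinSol (u κ j) * G' u| ≤ C := fun u => by
    rw [abs_mul]
    exact (mul_le_of_le_one_left (abs_nonneg _) (abs_steinSol_le _)).trans (hC' u)
  have hcoord : Continuous fun u : Fin m → Fin N → ℝ => u κ j := by fun_prop
  rw [hupd (fun u => trunc (u κ j) * G u) ((continuous_trunc.comp hcoord).mul hGc) hb1,
    hupd (fun u => steinSol (u κ j) * G' u) ((continuous_steinSol.comp hcoord).mul hGc') hb2]
  congr 1
  ext u
  congr 1
  ext a
  simp only [Function.update_self]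
  refine integral_trunc_mul_gaussianReal (C := C) (fun x => ?_) ?_ (fun x => hC _) fun x => hC' _
  · have := hG (Function.update u κ (Function.update a j x))
    simpa using this
  · exact hGc'.comp (continuous_const.update κ (continuous_const.update j continuous_id))

open scoped Matrix in
/-- The image of a standard Gaussian vector under a matrix `A` is Gaussian with covariance
`A Aᵀ`. -/
theorem map_mulVec_stdBlock {N : ℕ} {J : Type*} [Fintype J] [DecidableEq J]
    (A : Matrix J (Fin N) ℝ) :
    (stdBlock N).map (fun a => WithLp.toLp 2 (A *ᵥ a)) = multivariateGaussian 0 (A * Aᵀ) := by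
  have hps : (A * Aᵀ).PosSemidef := by
    have := Matrix.posSemidef_self_mul_conjTranspose A
    rwa [Matrix.conjTranspose_eq_transpose_of_trivial] at this
  have hm : Measurable fun a : Fin N → ℝ => WithLp.toLp 2 (A *ᵥ a) := by
    have : Continuous fun a : Fin N → ℝ => A *ᵥ a := by fun_prop
    fun_prop
  have : IsProbabilityMeasure ((stdBlock N).map (fun a => WithLp.toLp 2 (A *ᵥ a))) :=
    Measure.isProbabilityMeasure_map hm.aemeasurable
  apply Measure.ext_of_charFun
  ext t
  rw [charFun_multivariateGaussian hps, charFun_apply, integral_map hm.aemeasurable (by fun_prop)]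
  have h1 := charFun_stdGaussian (WithLp.toLp 2 (Aᵀ *ᵥ t.ofLp) : EuclideanSpace ℝ (Fin N))
  rw [← map_pi_eq_stdGaussian, charFun_apply, integral_map (by fun_prop) (by fun_prop)] at h1
  have hinner : ∀ a : Fin N → ℝ, inner ℝ (WithLp.toLp 2 (A *ᵥ a)) t =
      inner ℝ (WithLp.toLp 2 a) (WithLp.toLp 2 (Aᵀ *ᵥ t.ofLp) : EuclideanSpace ℝ (Fin N)) := by
    intro a
    simp only [EuclideanSpace.inner_eq_star_dotProduct, star_trivial]
    rw [Matrix.dotProduct_mulVec, Matrix.mulVec_transpose]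
  simp only [hinner, stdBlock]
  rw [h1]
  congr 1
  rw [← Matrix.mulVec_mulVec, Matrix.dotProduct_mulVec, ← Complex.ofReal_pow,
    EuclideanSpace.real_norm_sq_eq]
  simp [dotProduct, Matrix.mulVec_transpose, pow_two, neg_div]

/-- Rotation invariance of the standard Gaussian: `H Hᵀ = H² = I`. -/
theorem map_hadamard_stdBlock (n : ℕ) :
    (stdBlock (2 ^ n)).map (fun a => (hadamard n).mulVec a) = stdBlock (2 ^ n) := by
  have h := map_mulVec_stdBlock (hadamard n)
  rw [hadamard_symm, hadamard_mul_self, multivariateGaussian_zero_one, ← map_pi_eq_stdGaussian]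
    at h
  have h2 := congrArg (Measure.map (WithLp.ofLp (p := 2))) h
  have hc : Continuous fun a : Fin (2 ^ n) → ℝ => (hadamard n).mulVec a := by fun_prop
  rw [Measure.map_map (by fun_prop) (by have := hc.measurable; fun_prop),
    Measure.map_map (by fun_prop) (by fun_prop)] at h2
  simp only [Function.comp_def, Measure.map_id'] at h2
  exact h2

/-- The covariance factors as `A Aᵀ` with `A` the column of blocks `I`, `H`. The Gaussian is thus
degenerate, with `V` the deterministic image `H U`. -/
theorem gaussianBlocks_eq_map (k n : ℕ) :
    gaussianBlocks k n = (stdBlocks (k - 1) (2 ^ n)).map fun u κ =>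
      WithLp.toLp 2 (Sum.elim (u κ) ((hadamard n).mulVec (u κ))) := by
  set A : Matrix (Fin (2 ^ n) ⊕ Fin (2 ^ n)) (Fin (2 ^ n)) ℝ :=
    Matrix.fromRows 1 (hadamard n) with hAdef
  have hA : ∀ a : Fin (2 ^ n) → ℝ, A.mulVec a =
      Sum.elim a ((hadamard n).mulVec a) := fun a => by
    rw [hAdef, Matrix.fromRows_mulVec, Matrix.one_mulVec]
  have hcov : A * A.transpose = covMat n := by
    rw [hAdef, Matrix.transpose_fromRows, Matrix.fromRows_mul_fromCols, hadamard_symm, hadamard_mul_self]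
    simp [covMat]
  have h := map_mulVec_stdBlock A
  rw [hcov] at h
  simp only [hA] at h
  have hc : Continuous fun a : Fin (2 ^ n) → ℝ =>
      WithLp.toLp 2 (Sum.elim a ((hadamard n).mulVec a)) := by
    have : Continuous fun a : Fin (2 ^ n) → ℝ =>
        WithLp.toLp 2 (A.mulVec a) := by fun_prop
    simpa only [hA] using this
  have : IsProbabilityMeasure ((stdBlock (2 ^ n)).map fun a =>
      WithLp.toLp 2 (Sum.elim a ((hadamard n).mulVec a))) :=
    Measure.isProbabilityMeasure_map hc.measurable.aemeasurable
  rw [gaussianBlocks, ← h, stdBlocks,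
    Measure.pi_map_pi (f := fun _ (a : Fin (2 ^ n) → ℝ) =>
      (WithLp.toLp 2 (Sum.elim a ((hadamard n).mulVec a)) :
        EuclideanSpace ℝ (Fin (2 ^ n) ⊕ Fin (2 ^ n)))) fun _ => hc.measurable.aemeasurable]

/-! ### The means as functions of independent Gaussians -/

section

variable {k n : ℕ}

/-- The contribution `φ(U_b)` to the means in block `b`. -/
def leftFactor (u : Fin (k - 1) → Fin (2 ^ n) → ℝ) (p : Fin k × Fin (2 ^ n)) : ℝ :=
  if h : p.1.val < k - 1 then trunc (u ⟨p.1.val, h⟩ p.2) else 1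

/-- The contribution `φ(V_{b-1}) = φ(H U_{b-1})` to the means in block `b`. -/
def rightFactor (u : Fin (k - 1) → Fin (2 ^ n) → ℝ) (p : Fin k × Fin (2 ^ n)) : ℝ :=
  if h : 0 < p.1.val then trunc ((hadamard n).mulVec (u ⟨p.1.val - 1, by omega⟩) p.2) else 1

/-- The means `φ(U) ⋄ φ(H U)` with block `b` scaled by `ρ b`. -/
def scaledMeans (ρ : Fin k → ℝ) (u : Fin (k - 1) → Fin (2 ^ n) → ℝ)
    (p : Fin k × Fin (2 ^ n)) : ℝ :=
  ρ p.1 * (leftFactor u p * rightFactor u p)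

theorem means_toLp (u : Fin (k - 1) → Fin (2 ^ n) → ℝ) :
    means (fun κ => WithLp.toLp 2 (Sum.elim (u κ) ((hadamard n).mulVec (u κ)))) =
      scaledMeans (k := k) (fun _ => 1) u := by
  ext p
  simp [means, shiftedProd, scaledMeans, leftFactor, rightFactor]

theorem continuous_leftFactor (p : Fin k × Fin (2 ^ n)) :
    Continuous fun u : Fin (k - 1) → Fin (2 ^ n) → ℝ => leftFactor u p := by
  unfold leftFactor
  split_ifs
  · exact continuous_trunc.comp (by fun_prop)
  · exact continuous_const

theorem continuous_rightFactor (p : Fin k × Fin (2 ^ n)) :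
    Continuous fun u : Fin (k - 1) → Fin (2 ^ n) → ℝ => rightFactor u p := by
  unfold rightFactor
  split_ifs
  · refine continuous_trunc.comp ?_
    simp only [Matrix.mulVec, dotProduct]
    fun_prop
  · exact continuous_const

theorem continuous_scaledMeans (ρ : Fin k → ℝ) :
    Continuous fun u : Fin (k - 1) → Fin (2 ^ n) → ℝ => scaledMeans ρ u :=
  continuous_pi fun p => continuous_const.mul
    ((continuous_leftFactor p).mul (continuous_rightFactor p))

theorem abs_leftFactor_le (u : Fin (k - 1) → Fin (2 ^ n) → ℝ) (p : Fin k × Fin (2 ^ n)) :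
    |leftFactor u p| ≤ 1 := by
  unfold leftFactor
  split_ifs
  · exact (abs_trunc_le _).trans (by norm_num)
  · simp

theorem abs_left_mul_right_le (hk : 2 ≤ k) (u : Fin (k - 1) → Fin (2 ^ n) → ℝ)
    (p : Fin k × Fin (2 ^ n)) : |leftFactor u p * rightFactor u p| ≤ 1 / 2 := by
  have h := abs_means_le hk
    (fun κ => WithLp.toLp 2 (Sum.elim (u κ) ((hadamard n).mulVec (u κ)))) p
  rw [means_toLp] at h
  simpa [scaledMeans] using h

theorem abs_scaledMeans_le (hk : 2 ≤ k) {ρ : Fin k → ℝ} {c : ℝ} (hρ : ∀ b, |ρ b| ≤ c)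
    (u : Fin (k - 1) → Fin (2 ^ n) → ℝ) (p : Fin k × Fin (2 ^ n)) :
    |scaledMeans ρ u p| ≤ c * (1 / 2) := by
  rw [scaledMeans, abs_mul]
  exact mul_le_mul (hρ _) (abs_left_mul_right_le hk u p) (abs_nonneg _)
    ((abs_nonneg _).trans (hρ p.1))

/-! ### Dependence of the means on a single Gaussian vector or coordinate -/

theorem leftFactor_update {u : Fin (k - 1) → Fin (2 ^ n) → ℝ} {κ : Fin (k - 1)}
    {p : Fin k × Fin (2 ^ n)} (hp : p.1.val ≠ κ.val) (a : Fin (2 ^ n) → ℝ) :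
    leftFactor (Function.update u κ a) p = leftFactor u p := by
  unfold leftFactor
  split_ifs
  · rw [Function.update_of_ne]
    exact fun h => hp (congrArg Fin.val h)
  · rfl

theorem rightFactor_update {u : Fin (k - 1) → Fin (2 ^ n) → ℝ} {κ : Fin (k - 1)}
    {p : Fin k × Fin (2 ^ n)} (hp : p.1.val ≠ κ.val + 1) (a : Fin (2 ^ n) → ℝ) :
    rightFactor (Function.update u κ a) p = rightFactor u p := by
  unfold rightFactor
  split_ifs with h0
  · rw [Function.update_of_ne]
    intro h
    have := congrArg Fin.val h
    simp only at this
    omega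
  · rfl

theorem rightFactor_update_self {u : Fin (k - 1) → Fin (2 ^ n) → ℝ} {κ : Fin (k - 1)}
    {p : Fin k × Fin (2 ^ n)} (hp : p.1.val = κ.val + 1) (a : Fin (2 ^ n) → ℝ) :
    rightFactor (Function.update u κ a) p = trunc ((hadamard n).mulVec a p.2) := by
  have h0 : 0 < p.1.val := by omega
  have h1 : (⟨p.1.val - 1, by omega⟩ : Fin (k - 1)) = κ := Fin.ext (by simp; omega)
  unfold rightFactor
  rw [dif_pos h0, h1, Function.update_self]

theorem hasDerivAt_hadamard_mulVec_update (a : Fin (2 ^ n) → ℝ) (i j : Fin (2 ^ n)) (x : ℝ) :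
    HasDerivAt (fun y => (hadamard n).mulVec (Function.update a j y) i) (hadamard n i j) x := by
  simp only [Matrix.mulVec, dotProduct]
  have h1 := hasDerivAt_pi.1 (hasDerivAt_update a j x)
  have h2 := HasDerivAt.fun_sum (u := Finset.univ) fun l _ => (h1 l).const_mul (hadamard n i l)
  refine h2.congr_deriv ?_
  simp [Pi.single_apply]

/-- The block in which `U_κ` appears. -/
def leftBlock (κ : Fin (k - 1)) : Fin k := ⟨κ.val, by omega⟩

/-- The block in which `V_κ` appears. -/
def rightBlock (κ : Fin (k - 1)) : Fin k := ⟨κ.val + 1, by omega⟩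

theorem leftFactor_leftBlock (u : Fin (k - 1) → Fin (2 ^ n) → ℝ) (κ : Fin (k - 1))
    (j : Fin (2 ^ n)) : leftFactor u (leftBlock κ, j) = trunc (u κ j) := by
  simp [leftFactor, leftBlock]

/-- Coordinate `U_κ(j)` enters the means directly only at the excluded point, and otherwise through
`V_κ = H U_κ`, which lives in the next block. -/
theorem hasDerivAt_scaledMeans {ρ : Fin k → ℝ} (u : Fin (k - 1) → Fin (2 ^ n) → ℝ)
    (κ : Fin (k - 1)) (j : Fin (2 ^ n)) {p : Fin k × Fin (2 ^ n)} (hp : p ≠ (leftBlock κ, j)) :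
    HasDerivAt (fun y => scaledMeans ρ (Function.update u κ (Function.update (u κ) j y)) p)
      (if p.1 = rightBlock κ then ρ p.1 * (leftFactor u p *
        (gaussianPDFReal 0 1 ((hadamard n).mulVec (u κ) p.2) * hadamard n p.2 j)) else 0)
      (u κ j) := by
  by_cases h : p.1 = rightBlock κ
  · have h1 : p.1.val = κ.val + 1 := by rw [h]; rfl
    simp only [scaledMeans, leftFactor_update (show p.1.val ≠ κ.val by omega),
      rightFactor_update_self h1, if_pos h]
    refine HasDerivAt.const_mul _ (HasDerivAt.const_mul _ ?_)
    have hd := hasDerivAt_trunc ((hadamard n).mulVec (Function.update (u κ) j (u κ j)) p.2)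
    have := hd.comp (u κ j) (hasDerivAt_hadamard_mulVec_update (u κ) p.2 j (u κ j))
    rwa [Function.update_eq_self] at this
  · have h1 : p.1.val ≠ κ.val + 1 := fun h1 => h (Fin.ext h1)
    rw [if_neg h]
    have hconst : ∀ y, scaledMeans ρ (Function.update u κ (Function.update (u κ) j y)) p =
        scaledMeans ρ u p := by
      intro y
      simp only [scaledMeans, rightFactor_update h1]
      by_cases h2 : p.1.val = κ.val
      · have hj : p.2 ≠ j := fun hj => hp (Prod.ext (Fin.ext h2) hj)
        have hl : leftFactor (Function.update u κ (Function.update (u κ) j y)) p =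
            leftFactor u p := by
          obtain ⟨b, i⟩ := p
          obtain rfl : b = leftBlock κ := Fin.ext h2
          rw [leftFactor_leftBlock, leftFactor_leftBlock, Function.update_self,
            Function.update_of_ne hj]
        rw [hl]
      · rw [leftFactor_update h2]
    simp only [hconst]
    exact hasDerivAt_const _ _

/-- One step of a path. Membership `hj` kills the direct dependence on `U_κ(j)`, and `hS` ensures
that every point of the next block is new to `S`. -/
theorem hasDerivAt_mlDeriv_scaledMeans (f : Cube (Fin k × Fin (2 ^ n)) → ℝ) {ρ : Fin k → ℝ}
    (u : Fin (k - 1) → Fin (2 ^ n) → ℝ) (κ : Fin (k - 1)) (j : Fin (2 ^ n))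
    {S : Finset (Fin k × Fin (2 ^ n))} (hj : (leftBlock κ, j) ∈ S)
    (hS : ∀ p ∈ S, p.1 ≤ leftBlock κ) :
    HasDerivAt (fun y => mlDeriv f S
        (scaledMeans ρ (Function.update u κ (Function.update (u κ) j y))))
      (∑ i, (ρ (rightBlock κ) * (leftFactor u (rightBlock κ, i) *
        (gaussianPDFReal 0 1 ((hadamard n).mulVec (u κ) i) * hadamard n i j))) *
          mlDeriv f (insert (rightBlock κ, i) S) (scaledMeans ρ u)) (u κ j) := by
  refine (hasDerivAt_mlDeriv f S fun p hp => hasDerivAt_scaledMeans (ρ := ρ) u κ j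
    (by rintro rfl; exact hp hj)).congr_deriv ?_
  simp only [Function.update_eq_self]
  have hnot : ∀ i, (rightBlock κ, i) ∉ S := fun i hi => by
    have := hS _ hi
    simp [rightBlock, leftBlock, Fin.le_def] at this
  rw [Finset.sum_subset (Finset.subset_univ Sᶜ)]
  · rw [Fintype.sum_prod_type, Finset.sum_eq_single (rightBlock κ)]
    · simp
    · intro b _ hb
      simp [hb]
    · simp
  · intro p _ hp
    rw [if_neg, zero_mul]
    intro h
    have : p ∈ S := by simpa using hp
    exact hnot p.2 (h ▸ this)

/-! ### Counting the sets reached by paths -/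

/-- The extensions of `S` to a set of size `m` by points beyond block `b`. -/
def extensions (b : Fin k) (S : Finset (Fin k × Fin (2 ^ n))) (m : ℕ) :
    Finset (Finset (Fin k × Fin (2 ^ n))) :=
  {T ∈ Finset.univ.powersetCard m | T.filter (fun p => p.1 ≤ b) = S}

/-- The part of `T` in blocks up to `b` recovers `s i`, so the families for different `i` are
disjoint and no `T` is counted twice. -/
theorem sum_extensions_le {ι : Type*} [Fintype ι] {b : Fin k}
    {s : ι → Finset (Fin k × Fin (2 ^ n))} (hs : Function.Injective s) {m : ℕ}
    {A : Finset (Finset (Fin k × Fin (2 ^ n)))} (hA : ∀ i, extensions b (s i) m ⊆ A)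
    {g : Finset (Fin k × Fin (2 ^ n)) → ℝ} (hg : ∀ T, 0 ≤ g T) :
    ∑ i, ∑ T ∈ extensions b (s i) m, g T ≤ ∑ T ∈ A, g T := by
  rw [← Finset.sum_biUnion]
  · exact Finset.sum_le_sum_of_subset_of_nonneg (Finset.biUnion_subset.2 fun i _ => hA i)
      fun T _ _ => hg T
  · intro i _ i' _ hne
    refine Finset.disjoint_left.2 fun T hT hT' => hne (hs ?_)
    rw [← (Finset.mem_filter.1 hT).2, ← (Finset.mem_filter.1 hT').2]

theorem extensions_insert_subset {κ : Fin (k - 1)} {S : Finset (Fin k × Fin (2 ^ n))}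
    (hS : ∀ p ∈ S, p.1 ≤ leftBlock κ) (i : Fin (2 ^ n)) (m : ℕ) :
    extensions (rightBlock κ) (insert (rightBlock κ, i) S) m ⊆ extensions (leftBlock κ) S m := by
  intro T hT
  obtain ⟨h1, h2⟩ := Finset.mem_filter.1 hT
  refine Finset.mem_filter.2 ⟨h1, ?_⟩
  have h3 : T.filter (fun p => p.1 ≤ leftBlock κ) =
      (T.filter (fun p => p.1 ≤ rightBlock κ)).filter (fun p => p.1 ≤ leftBlock κ) := by
    ext p
    simp only [Finset.mem_filter, leftBlock, rightBlock, Fin.le_def]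
    constructor
    · rintro ⟨h, h'⟩
      exact ⟨⟨h, by omega⟩, h'⟩
    · rintro ⟨⟨h, -⟩, h'⟩
      exact ⟨h, h'⟩
  rw [h3, h2, Finset.filter_insert, if_neg, Finset.filter_true_of_mem hS]
  simp [leftBlock, rightBlock, Fin.le_def]

theorem insert_rightBlock_injective {κ : Fin (k - 1)} {S : Finset (Fin k × Fin (2 ^ n))}
    (hS : ∀ p ∈ S, p.1 ≤ leftBlock κ) :
    Function.Injective fun i : Fin (2 ^ n) => insert (rightBlock κ, i) S := by
  intro i i' h
  have h1 : (rightBlock κ, i) ∈ insert (rightBlock κ, i') S := by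
    rw [← show insert (rightBlock κ, i) S = insert (rightBlock κ, i') S from h]
    exact Finset.mem_insert_self _ _
  rcases Finset.mem_insert.1 h1 with h2 | h2
  · exact (Prod.ext_iff.1 h2).2
  · have := hS _ h2
    simp [rightBlock, leftBlock, Fin.le_def] at this

theorem abs_hadamard (i j : Fin (2 ^ n)) : |hadamard n i j| = 1 / √(2 ^ n) := by
  rw [hadamard, abs_div, abs_pow, abs_neg, abs_one, one_pow, abs_of_nonneg (Real.sqrt_nonneg _)]

theorem continuous_mlDeriv_scaledMeans (f : Cube (Fin k × Fin (2 ^ n)) → ℝ) (ρ : Fin k → ℝ)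
    (S : Finset (Fin k × Fin (2 ^ n))) :
    Continuous fun u : Fin (k - 1) → Fin (2 ^ n) → ℝ => mlDeriv f S (scaledMeans ρ u) :=
  (continuous_mlDeriv f S).comp (continuous_scaledMeans ρ)

theorem integrable_abs_mlDeriv_scaledMeans (hk : 2 ≤ k) (f : Cube (Fin k × Fin (2 ^ n)) → ℝ)
    {ρ : Fin k → ℝ} (hρ : ∀ b, |ρ b| ≤ 1) (S : Finset (Fin k × Fin (2 ^ n))) :
    Integrable (fun u => |mlDeriv f S (scaledMeans ρ u)|) (stdBlocks (k - 1) (2 ^ n)) := by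
  obtain ⟨C, hC⟩ := exists_abs_mlDeriv_le f
  refine integrable_of_continuous_of_abs_le (C := C)
    (continuous_mlDeriv_scaledMeans f ρ S).abs fun u => ?_
  rw [abs_abs]
  exact hC S _ fun p => (abs_scaledMeans_le hk hρ u p).trans (by norm_num)

/-- Following a path through the blocks `b, b + 1, …, k - 1`: each step gains an entry of the
Hadamard matrix and a derivative of `f` in the next block. -/
theorem abs_integral_path_le (hk : 2 ≤ k) (f : Cube (Fin k × Fin (2 ^ n)) → ℝ) {ρ : Fin k → ℝ}
    (hρ : ∀ b, |ρ b| ≤ 1) (d : ℕ) : ∀ (b : Fin k), b.val + d = k - 1 →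
    ∀ (S : Finset (Fin k × Fin (2 ^ n))) (j : Fin (2 ^ n)), (b, j) ∈ S → (∀ p ∈ S, p.1 ≤ b) →
    ∀ (P : (Fin (k - 1) → Fin (2 ^ n) → ℝ) → ℝ) (B : ℝ), Continuous P → (∀ u, |P u| ≤ B) →
    (∀ u (κ : Fin (k - 1)) a, b.val ≤ κ.val → P (Function.update u κ a) = P u) →
    |∫ u, P u * (leftFactor u (b, j) * mlDeriv f S (scaledMeans ρ u))
        ∂(stdBlocks (k - 1) (2 ^ n))| ≤
      (1 / √(2 ^ n)) ^ d * B * ∫ u, ∑ T ∈ extensions b S (S.card + d),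
        |mlDeriv f T (scaledMeans ρ u)| ∂(stdBlocks (k - 1) (2 ^ n)) := by
  obtain ⟨C, hC⟩ := exists_abs_mlDeriv_le f
  have hb : ∀ S u, |mlDeriv f S (scaledMeans ρ u)| ≤ C := fun S u =>
    hC S _ fun p => (abs_scaledMeans_le hk hρ u p).trans (by norm_num)
  have hint := integrable_abs_mlDeriv_scaledMeans hk f hρ
  have hC0 : 0 ≤ C := (abs_nonneg _).trans (hb ∅ 0)
  induction d with
  | zero =>
    intro b hbd S j hj hS P B hP hPB _
    have hB : 0 ≤ B := (abs_nonneg _).trans (hPB 0)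
    -- The last block carries no `U` factor, so the path stops here, and `S` is one of its own
    -- extensions.
    have hl : ∀ u : Fin (k - 1) → Fin (2 ^ n) → ℝ, leftFactor u (b, j) = 1 := fun u => by
      simp only [leftFactor]
      rw [dif_neg (by omega)]
    have hmem : S ∈ extensions b S (S.card + 0) :=
      Finset.mem_filter.2 ⟨Finset.mem_powersetCard.2 ⟨Finset.subset_univ _, rfl⟩,
        Finset.filter_true_of_mem hS⟩
    rw [pow_zero, one_mul, ← integral_const_mul]
    refine (abs_integral_le_integral_abs).trans (integral_mono_of_nonneg
      (Filter.Eventually.of_forall fun u => abs_nonneg _)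
      ((integrable_finsetSum _ fun T _ => hint T).const_mul B)
      (Filter.Eventually.of_forall fun u => ?_))
    simp only [hl, one_mul, abs_mul]
    exact mul_le_mul (hPB u) (Finset.single_le_sum
      (f := fun T => |mlDeriv f T (scaledMeans ρ u)|) (fun T _ => abs_nonneg _) hmem)
      (abs_nonneg _) hB
  | succ d ih =>
    intro b hbd S j hj hS P B hP hPB hPu
    have hB : 0 ≤ B := (abs_nonneg _).trans (hPB 0)
    obtain ⟨κ, rfl⟩ : ∃ κ : Fin (k - 1), b = leftBlock κ :=
      ⟨⟨b.val, by omega⟩, rfl⟩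
    have hκ : (leftBlock κ).val = κ.val := rfl
    -- The new prefactor absorbs every bounded factor except the Hadamard entry and `φ(U_{κ+1}(i))`.
    -- Each absorbed factor is at most `1` in absolute value, so the bound `B` persists. They
    -- involve only `U_κ`, which later steps never differentiate.
    set Q : Fin (2 ^ n) → (Fin (k - 1) → Fin (2 ^ n) → ℝ) → ℝ := fun i u =>
      P u * steinSol (u κ j) * gaussianPDFReal 0 1 ((hadamard n).mulVec (u κ) i) *
        ρ (rightBlock κ) with hQ
    have hmv : ∀ i, Continuous fun u : Fin (k - 1) → Fin (2 ^ n) → ℝ =>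
        (hadamard n).mulVec (u κ) i := fun i => by
      simp only [Matrix.mulVec, dotProduct]
      fun_prop
    have hQc : ∀ i, Continuous (Q i) := fun i =>
      ((hP.mul (continuous_steinSol.comp (by fun_prop))).mul
        (continuous_gaussianPDFReal.comp (hmv i))).mul continuous_const
    have hpdf : ∀ x, |gaussianPDFReal 0 1 x| ≤ 1 := fun x => by
      rw [abs_of_pos (gaussianPDFReal_pos' x)]
      exact gaussianPDFReal_le_one x
    have hQB : ∀ i u, |Q i u| ≤ B := fun i u => by
      simp only [hQ, abs_mul]
      have h1 := mul_le_mul (hPB u) (abs_steinSol_le (u κ j)) (abs_nonneg _) hB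
      have h2 := mul_le_mul h1 (hpdf ((hadamard n).mulVec (u κ) i)) (abs_nonneg _) (by simpa)
      have h3 := mul_le_mul h2 (hρ (rightBlock κ)) (abs_nonneg _) (by simpa)
      simpa using h3
    have hQu : ∀ i u (κ' : Fin (k - 1)) a, (rightBlock κ).val ≤ κ'.val →
        Q i (Function.update u κ' a) = Q i u := by
      intro i u κ' a h
      have h' : κ.val + 1 ≤ κ'.val := h
      have hne : κ ≠ κ' := fun h => by rw [h] at h'; omega
      simp only [hQ, Function.update_of_ne hne]
      rw [hPu u κ' a (by omega)]
    have hQint : ∀ i, Integrable (fun u => Q i u * (leftFactor u (rightBlock κ, i) *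
        mlDeriv f (insert (rightBlock κ, i) S) (scaledMeans ρ u)))
          (stdBlocks (k - 1) (2 ^ n)) := fun i =>
      integrable_of_continuous_of_abs_le (C := B * (1 * C)) ((hQc i).mul
        ((continuous_leftFactor _).mul (continuous_mlDeriv_scaledMeans f ρ _))) fun u => by
          rw [abs_mul, abs_mul (leftFactor u _)]
          exact mul_le_mul (hQB i u) (mul_le_mul (abs_leftFactor_le u _) (hb _ u) (abs_nonneg _)
            zero_le_one) (by positivity) hB
    set D : (Fin (k - 1) → Fin (2 ^ n) → ℝ) → ℝ := fun u =>
      ∑ i, (ρ (rightBlock κ) * (leftFactor u (rightBlock κ, i) *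
        (gaussianPDFReal 0 1 ((hadamard n).mulVec (u κ) i) * hadamard n i j))) *
          mlDeriv f (insert (rightBlock κ, i) S) (scaledMeans ρ u) with hD
    have hDc : Continuous D := continuous_finsetSum _ fun i _ =>
      (continuous_const.mul ((continuous_leftFactor _).mul
        ((continuous_gaussianPDFReal.comp (hmv i)).mul continuous_const))).mul
          (continuous_mlDeriv_scaledMeans f ρ _)
    have hDb : ∀ u, |D u| ≤ ∑ i, (1 * (1 * (1 * |hadamard n i j|))) * C := fun u => by
      refine (Finset.abs_sum_le_sum_abs _ _).trans (Finset.sum_le_sum fun i _ => ?_)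
      simp only [abs_mul]
      gcongr
      · exact hρ _
      · exact abs_leftFactor_le _ _
      · exact hpdf _
      · exact hb _ _
    -- Only finiteness matters here: this common bound justifies the integration by parts and does
    -- not enter the final estimate.
    set C' : ℝ := max C (∑ i, (1 * (1 * (1 * |hadamard n i j|))) * C)
    have hstein := integral_trunc_mul_stdBlocks κ j
      (G := fun u => P u * mlDeriv f S (scaledMeans ρ u)) (G' := fun u => P u * D u)
      (C := B * C') (hP.mul (continuous_mlDeriv_scaledMeans f ρ S)) (hP.mul hDc)
      (fun u => by
        have h1 : ∀ y, P (Function.update u κ (Function.update (u κ) j y)) = P u :=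
          fun y => hPu _ _ _ le_rfl
        simp only [h1]
        exact (hasDerivAt_mlDeriv_scaledMeans f u κ j hj hS).const_mul (P u))
      (fun u => by
        rw [abs_mul]
        exact mul_le_mul (hPB u) ((hb S u).trans (le_max_left _ _)) (abs_nonneg _) hB)
      (fun u => by
        rw [abs_mul]
        exact mul_le_mul (hPB u) ((hDb u).trans (le_max_right _ _)) (abs_nonneg _) hB)
    have hstep : ∫ u, P u * (leftFactor u (leftBlock κ, j) * mlDeriv f S (scaledMeans ρ u))
        ∂(stdBlocks (k - 1) (2 ^ n)) = ∑ i, hadamard n i j * ∫ u, Q i u *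
          (leftFactor u (rightBlock κ, i) *
            mlDeriv f (insert (rightBlock κ, i) S) (scaledMeans ρ u))
              ∂(stdBlocks (k - 1) (2 ^ n)) := by
      calc _ = ∫ u, trunc (u κ j) * (P u * mlDeriv f S (scaledMeans ρ u))
            ∂(stdBlocks (k - 1) (2 ^ n)) := by
              congr 1
              ext u
              rw [leftFactor_leftBlock]
              ring
        _ = ∫ u, ∑ i, hadamard n i j * (Q i u * (leftFactor u (rightBlock κ, i) *
              mlDeriv f (insert (rightBlock κ, i) S) (scaledMeans ρ u)))
                ∂(stdBlocks (k - 1) (2 ^ n)) := by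
              rw [hstein]
              congr 1
              ext u
              simp only [hD, hQ, Finset.mul_sum]
              exact Finset.sum_congr rfl fun i _ => by ring
        _ = _ := by
              rw [integral_finsetSum _ fun i _ => (hQint i).const_mul _]
              exact Finset.sum_congr rfl fun i _ => integral_const_mul _ _
    rw [hstep]
    have hcard : ∀ i, (insert (rightBlock κ, i) S).card + d = S.card + (d + 1) := fun i => by
      rw [Finset.card_insert_of_notMem, add_assoc, add_comm 1 d]
      intro h
      have := hS _ h
      simp [rightBlock, leftBlock, Fin.le_def] at this
    have hi : ∀ i, |∫ u, Q i u * (leftFactor u (rightBlock κ, i) *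
            mlDeriv f (insert (rightBlock κ, i) S) (scaledMeans ρ u))
              ∂(stdBlocks (k - 1) (2 ^ n))| ≤ (1 / √(2 ^ n)) ^ d * B * ∫ u,
        ∑ T ∈ extensions (rightBlock κ) (insert (rightBlock κ, i) S) (S.card + (d + 1)),
          |mlDeriv f T (scaledMeans ρ u)| ∂(stdBlocks (k - 1) (2 ^ n)) := fun i => by
      have := ih (rightBlock κ) (by simp only [rightBlock]; omega) (insert (rightBlock κ, i) S) i
        (Finset.mem_insert_self _ _) (fun p hp => by
          rcases Finset.mem_insert.1 hp with rfl | hp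
          · exact le_rfl
          · exact (hS p hp).trans (by simp [leftBlock, rightBlock, Fin.le_def]))
        (Q i) B (hQc i) (hQB i) (hQu i)
      rwa [hcard] at this
    calc |∑ i, hadamard n i j * ∫ u, Q i u * (leftFactor u (rightBlock κ, i) *
            mlDeriv f (insert (rightBlock κ, i) S) (scaledMeans ρ u))
              ∂(stdBlocks (k - 1) (2 ^ n))|
        ≤ ∑ i, (1 / √(2 ^ n)) * ((1 / √(2 ^ n)) ^ d * B * ∫ u,
          ∑ T ∈ extensions (rightBlock κ) (insert (rightBlock κ, i) S) (S.card + (d + 1)),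
            |mlDeriv f T (scaledMeans ρ u)| ∂(stdBlocks (k - 1) (2 ^ n))) := by
          refine (Finset.abs_sum_le_sum_abs _ _).trans (Finset.sum_le_sum fun i _ => ?_)
          rw [abs_mul, abs_hadamard]
          exact mul_le_mul_of_nonneg_left (hi i) (by positivity)
      _ = (1 / √(2 ^ n)) ^ (d + 1) * B * ∫ u, ∑ i,
          ∑ T ∈ extensions (rightBlock κ) (insert (rightBlock κ, i) S) (S.card + (d + 1)),
            |mlDeriv f T (scaledMeans ρ u)| ∂(stdBlocks (k - 1) (2 ^ n)) := by
          rw [integral_finsetSum _ fun i _ => integrable_finsetSum _ fun T _ => hint T,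
            ← Finset.mul_sum, ← Finset.mul_sum]
          ring
      _ ≤ _ := by
          refine mul_le_mul_of_nonneg_left (integral_mono
            (integrable_finsetSum _ fun i _ => integrable_finsetSum _ fun T _ => hint T)
            (integrable_finsetSum _ fun T _ => hint T) fun u => ?_) (by positivity)
          exact sum_extensions_le (insert_rightBlock_injective hS)
            (fun i => extensions_insert_subset hS i _) fun T => abs_nonneg _

end

section

variable {k n : ℕ}

/-! ### Averaging out a block whose means are independent and centered -/

/-- A multilinear function of independent coordinates averages to its value at their means, and `φ`
of a standard Gaussian is centered. -/
theorem integral_mlDeriv_independent_block (f : Cube (Fin k × Fin (2 ^ n)) → ℝ) (b : Fin k)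
    (q w : Fin k × Fin (2 ^ n) → ℝ) :
    ∫ a, mlDeriv f ∅ (fun p => if p.1 = b then q p * trunc (a p.2) else w p)
        ∂(stdBlock (2 ^ n)) =
      mlDeriv f ∅ (fun p => if p.1 = b then 0 else w p) := by
  simp only [mlDeriv, Finset.notMem_empty, if_false]
  have htr : Integrable trunc (gaussianReal 0 1) :=
    integrable_of_continuous_of_abs_le continuous_trunc abs_trunc_le
  -- Grouping by column `i` makes each factor a function of `a i` alone, so the integral of the
  -- product factors.
  have hprod : ∀ (z : Cube (Fin k × Fin (2 ^ n))) (a : Fin (2 ^ n) → ℝ),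
      ∏ p : Fin k × Fin (2 ^ n),
        (1 + (if p.1 = b then q p * trunc (a p.2) else w p) * ((z p : ℤ) : ℝ)) / 2 =
      ∏ i, ((1 + q (b, i) * trunc (a i) * ((z (b, i) : ℤ) : ℝ)) / 2 *
        ∏ b' ∈ Finset.univ.erase b, (1 + w (b', i) * ((z (b', i) : ℤ) : ℝ)) / 2) := by
    intro z a
    rw [Fintype.prod_prod_type_right]
    refine Finset.prod_congr rfl fun i _ => ?_
    rw [← Finset.mul_prod_erase _ _ (Finset.mem_univ b), if_pos rfl]
    congr 1
    exact Finset.prod_congr rfl fun b' hb' => by rw [if_neg (Finset.ne_of_mem_erase hb')]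
  have hprod0 : ∀ (z : Cube (Fin k × Fin (2 ^ n))),
      ∏ p : Fin k × Fin (2 ^ n),
        (1 + (if p.1 = b then 0 else w p) * ((z p : ℤ) : ℝ)) / 2 =
      ∏ i, (1 / 2 * ∏ b' ∈ Finset.univ.erase b,
        (1 + w (b', i) * ((z (b', i) : ℤ) : ℝ)) / 2) := by
    intro z
    rw [Fintype.prod_prod_type_right]
    refine Finset.prod_congr rfl fun i _ => ?_
    rw [← Finset.mul_prod_erase _ _ (Finset.mem_univ b), if_pos rfl, zero_mul, add_zero]
    congr 1
    exact Finset.prod_congr rfl fun b' hb' => by rw [if_neg (Finset.ne_of_mem_erase hb')]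
  simp only [hprod, hprod0]
  rw [integral_finsetSum]
  · refine Finset.sum_congr rfl fun z _ => ?_
    rw [integral_const_mul, stdBlock, integral_fintype_prod_eq_prod (f := fun i x =>
      (1 + q (b, i) * trunc x * ((z (b, i) : ℤ) : ℝ)) / 2 *
        ∏ b' ∈ Finset.univ.erase b, (1 + w (b', i) * ((z (b', i) : ℤ) : ℝ)) / 2)]
    congr 1
    refine Finset.prod_congr rfl fun i _ => ?_
    rw [integral_mul_const, integral_div, integral_add (integrable_const _)
      ((htr.const_mul _).mul_const _), integral_mul_const, integral_const_mul,
      integral_trunc_gaussianReal]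
    simp
  · intro z _
    refine Integrable.const_mul ?_ _
    exact Integrable.fintype_prod (f := fun i x =>
      (1 + q (b, i) * trunc x * ((z (b, i) : ℤ) : ℝ)) / 2 *
        ∏ b' ∈ Finset.univ.erase b, (1 + w (b', i) * ((z (b', i) : ℤ) : ℝ)) / 2) fun i =>
      ((((integrable_const _).add ((htr.const_mul _).mul_const _)).div_const 2).mul_const _)

/-- Once the block containing `U_κ` is zero, `U_κ` acts only through `V_κ` in the next block.
Resampling `U_κ` makes `V_κ` a fresh standard Gaussian vector, so that block averages out as well.
-/
theorem integral_mlDeriv_zero_blocks_succ (hk : 2 ≤ k) (f : Cube (Fin k × Fin (2 ^ n)) → ℝ)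
    (κ : Fin (k - 1)) :
    ∫ u, mlDeriv f ∅ (scaledMeans (fun b => if b ≤ leftBlock κ then 0 else 1) u)
        ∂(stdBlocks (k - 1) (2 ^ n)) =
      ∫ u, mlDeriv f ∅ (scaledMeans (fun b => if b ≤ rightBlock κ then 0 else 1) u)
        ∂(stdBlocks (k - 1) (2 ^ n)) := by
  obtain ⟨C, hC⟩ := exists_abs_mlDeriv_le f
  have hρ : ∀ b : Fin k, |if b ≤ leftBlock κ then (0 : ℝ) else 1| ≤ 1 := fun b => by
    split_ifs <;> simp
  rw [stdBlocks, integral_pi_eq_integral_update _ κ (integrable_of_continuous_of_abs_le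
    (continuous_mlDeriv_scaledMeans f _ ∅) fun u =>
      hC ∅ _ fun p => (abs_scaledMeans_le hk hρ u p).trans (by norm_num))]
  congr 1
  ext u
  have hL : (leftBlock κ).val = κ.val := rfl
  have hR : (rightBlock κ).val = κ.val + 1 := rfl
  set w := scaledMeans (fun b => if b ≤ leftBlock κ then 0 else 1) u with hw
  have h1 : ∀ a, scaledMeans (fun b => if b ≤ leftBlock κ then 0 else 1)
      (Function.update u κ a) = fun p => if p.1 = rightBlock κ then
        leftFactor u p * trunc ((hadamard n).mulVec a p.2) else w p := by
    intro a
    ext p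
    by_cases hp : p.1 = rightBlock κ
    · have hp' : p.1.val = κ.val + 1 := by rw [hp]; rfl
      have : ¬ p.1 ≤ leftBlock κ := by rw [Fin.le_def]; omega
      rw [if_pos hp, scaledMeans, if_neg this, one_mul, rightFactor_update_self hp',
        leftFactor_update (by omega)]
    · have hp' : p.1.val ≠ κ.val + 1 := fun h => hp (Fin.ext h)
      rw [if_neg hp, hw, scaledMeans, scaledMeans, rightFactor_update hp']
      by_cases hle : p.1 ≤ leftBlock κ
      · simp [hle]
      · rw [leftFactor_update]
        rw [Fin.le_def] at hle
        omega
  have h2 : scaledMeans (fun b => if b ≤ rightBlock κ then 0 else 1) u =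
      fun p => if p.1 = rightBlock κ then 0 else w p := by
    ext p
    by_cases hp : p.1 = rightBlock κ
    · simp [scaledMeans, hp]
    · have hp' : p.1.val ≠ κ.val + 1 := fun h => hp (Fin.ext h)
      have : p.1 ≤ rightBlock κ ↔ p.1 ≤ leftBlock κ := by
        rw [Fin.le_def, Fin.le_def]
        omega
      simp [scaledMeans, hw, hp, this]
  rw [h2, ← integral_mlDeriv_independent_block f (rightBlock κ) (leftFactor u) w]
  simp only [h1]
  conv_rhs => rw [← map_hadamard_stdBlock]
  have hc : Continuous fun a : Fin (2 ^ n) → ℝ => (hadamard n).mulVec a := by fun_prop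
  rw [integral_map hc.measurable.aemeasurable]
  refine Continuous.aestronglyMeasurable ((continuous_mlDeriv f ∅).comp (continuous_pi fun p => ?_))
  split_ifs
  · exact continuous_const.mul (continuous_trunc.comp (continuous_apply _))
  · exact continuous_const

theorem integral_mlDeriv_zero_blocks (hk : 2 ≤ k) (f : Cube (Fin k × Fin (2 ^ n)) → ℝ)
    (c : ℕ) : ∀ b : Fin k, b.val + c = k - 1 →
    ∫ u, mlDeriv f ∅ (scaledMeans (fun b' => if b' ≤ b then 0 else 1) u)
        ∂(stdBlocks (k - 1) (2 ^ n)) = mlDeriv f ∅ 0 := by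
  induction c with
  | zero =>
    intro b hb
    have : ∀ u : Fin (k - 1) → Fin (2 ^ n) → ℝ,
        scaledMeans (fun b' : Fin k => if b' ≤ b then 0 else 1) u = 0 := fun u => by
      ext p
      have : p.1 ≤ b := by rw [Fin.le_def]; omega
      simp [scaledMeans, this]
    simp [this]
  | succ c ih =>
    intro b hb
    obtain ⟨κ, rfl⟩ : ∃ κ : Fin (k - 1), b = leftBlock κ := ⟨⟨b.val, by omega⟩, rfl⟩
    have hL : (leftBlock κ).val = κ.val := rfl
    have hR : (rightBlock κ).val = κ.val + 1 := rfl
    rw [integral_mlDeriv_zero_blocks_succ hk, ih _ (by omega)]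

/-! ### Switching on the first block -/

/-- The weights which scale the block `b₀` by `r`. -/
def scaleAt (b₀ : Fin k) (r : ℝ) (b : Fin k) : ℝ := if b = b₀ then r else 1

/-- Only the first block depends on the scale, linearly with slope `φ(U_1)`, since that block has no
`V` factor. -/
theorem hasDerivAt_integral_mlDeriv_scaleAt (hk : 2 ≤ k) (f : Cube (Fin k × Fin (2 ^ n)) → ℝ)
    {b₀ : Fin k} (hb₀ : b₀.val = 0) {r : ℝ} (hr : |r| ≤ 1) :
    HasDerivAt (fun s => ∫ u, mlDeriv f ∅ (scaledMeans (scaleAt b₀ s) u)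
        ∂(stdBlocks (k - 1) (2 ^ n)))
      (∫ u, ∑ i, leftFactor u (b₀, i) * mlDeriv f {(b₀, i)} (scaledMeans (scaleAt b₀ r) u)
        ∂(stdBlocks (k - 1) (2 ^ n))) r := by
  obtain ⟨C, hC⟩ := exists_abs_mlDeriv_le f
  -- Scales up to `2` are harmless: the unscaled means are at most `1/2`, so the scaled ones stay in
  -- `[-1, 1]`, where the uniform bound `C` holds.
  have hscale : ∀ s ∈ Metric.ball r 1, ∀ b, |scaleAt b₀ s b| ≤ 2 := fun s hs b => by
    unfold scaleAt
    split_ifs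
    · rw [Metric.mem_ball, Real.dist_eq] at hs
      calc |s| = |(s - r) + r| := by ring_nf
        _ ≤ |s - r| + |r| := abs_add_le _ _
        _ ≤ 2 := by linarith
    · norm_num
  have hb : ∀ S, ∀ s ∈ Metric.ball r 1, ∀ u : Fin (k - 1) → Fin (2 ^ n) → ℝ,
      |mlDeriv f S (scaledMeans (scaleAt b₀ s) u)| ≤ C := fun S s hs u =>
    hC S _ fun p => (abs_scaledMeans_le hk (hscale s hs) u p).trans (by norm_num)
  have hr0 : r ∈ Metric.ball r 1 := Metric.mem_ball_self one_pos
  refine (hasDerivAt_integral_of_dominated_loc_of_deriv_le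
    (F := fun s u => mlDeriv f ∅ (scaledMeans (scaleAt b₀ s) u))
    (F' := fun s u => ∑ i : Fin (2 ^ n), leftFactor u (b₀, i) *
      mlDeriv f {(b₀, i)} (scaledMeans (scaleAt b₀ s) u))
    (bound := fun _ => ∑ _i : Fin (2 ^ n), 1 * C)
    (Metric.ball_mem_nhds r one_pos) ?_ ?_ ?_ ?_ (integrable_const _) ?_).2
  · exact Filter.Eventually.of_forall fun s =>
      (continuous_mlDeriv_scaledMeans f _ ∅).aestronglyMeasurable
  · exact integrable_of_continuous_of_abs_le (continuous_mlDeriv_scaledMeans f _ ∅) (hb ∅ r hr0)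
  · exact (continuous_finsetSum _ fun i _ => (continuous_leftFactor _).mul
      (continuous_mlDeriv_scaledMeans f _ _)).aestronglyMeasurable
  · refine Filter.Eventually.of_forall fun u s hs => ?_
    refine (Finset.abs_sum_le_sum_abs _ _).trans (Finset.sum_le_sum fun i _ => ?_)
    rw [abs_mul]
    exact mul_le_mul (abs_leftFactor_le _ _) (hb _ s hs u) (abs_nonneg _) zero_le_one
  · refine Filter.Eventually.of_forall fun u s _ => ?_
    have hd : ∀ p : Fin k × Fin (2 ^ n), HasDerivAt (fun y => scaledMeans (scaleAt b₀ y) u p)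
        (if p.1 = b₀ then leftFactor u p else 0) s := fun p => by
      by_cases hp : p.1 = b₀
      · have h1 : rightFactor u p = 1 := by
          unfold rightFactor
          rw [dif_neg (by rw [hp]; omega)]
        simpa [scaledMeans, scaleAt, hp, h1] using (hasDerivAt_id s).mul_const (leftFactor u p)
      · simpa [scaledMeans, scaleAt, hp] using
          hasDerivAt_const s (leftFactor u p * rightFactor u p)
    refine (hasDerivAt_mlDeriv f ∅ fun p _ => hd p).congr_deriv ?_
    rw [Finset.compl_empty, Fintype.sum_prod_type, Finset.sum_eq_single b₀]
    · simp
    · intro b _ hb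
      simp [hb]
    · simp

/-- Mean value inequality in the scale of the first block. The paths start from the singletons
`{(b₀, i)}` with prefactor `1`. The sum over `k`-sets is kept inside the expectation, so `hM`
applies pointwise at means in `[-1/2, 1/2]`. -/
theorem abs_integral_sub_le (hk : 2 ≤ k) (f : Cube (Fin k × Fin (2 ^ n)) → ℝ) {M : ℝ}
    (hM : ∀ μ : Fin k × Fin (2 ^ n) → ℝ, (∀ p, |μ p| ≤ 1 / 2) →
      ∑ T ∈ (Finset.univ : Finset (Fin k × Fin (2 ^ n))).powersetCard k, |mlDeriv f T μ| ≤ M) :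
    |∫ z, f z ∂(p1 k n) - ∫ z, f z ∂(p0 k n)| ≤ (1 / √(2 ^ n)) ^ (k - 1) * M := by
  have hp1 : ∫ z, f z ∂(p1 k n) = ∫ u, mlDeriv f ∅ (scaledMeans (fun _ => 1) u)
      ∂(stdBlocks (k - 1) (2 ^ n)) := by
    have hprob : IsProbabilityMeasure (gaussianBlocks k n) := by
      unfold gaussianBlocks
      infer_instance
    rw [p1, integral_bind_biasedMeasure _ measurable_means fun g p =>
      (abs_means_le hk g p).trans (by norm_num), gaussianBlocks_eq_map, integral_map]
    · simp only [means_toLp]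
    · refine Continuous.aemeasurable (continuous_pi fun κ => ?_)
      refine (PiLp.continuous_toLp 2 _).comp (continuous_pi fun s => ?_)
      cases s with
      | inl i =>
        simp only [Sum.elim_inl]
        fun_prop
      | inr i =>
        simp only [Sum.elim_inr, Matrix.mulVec, dotProduct]
        fun_prop
    · exact ((continuous_mlDeriv f ∅).measurable.comp measurable_means).aestronglyMeasurable
  set b₀ : Fin k := ⟨0, by omega⟩ with hb₀
  set F : ℝ → ℝ := fun s => ∫ u, mlDeriv f ∅ (scaledMeans (scaleAt b₀ s) u)
        ∂(stdBlocks (k - 1) (2 ^ n)) with hF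
  have hF1 : ∫ z, f z ∂(p1 k n) = F 1 := by
    have : scaleAt b₀ 1 = fun _ => 1 := by
      ext b
      simp [scaleAt]
    simp only [hp1, hF, this]
  have hF0 : ∫ z, f z ∂(p0 k n) = F 0 := by
    have : scaleAt b₀ 0 = fun b => if b ≤ b₀ then 0 else 1 := by
      ext b
      have : b ≤ b₀ ↔ b = b₀ := by
        rw [Fin.le_def, Fin.ext_iff]
        simp [hb₀]
      simp [scaleAt, this]
    simp only [hF, this]
    rw [p0, integral_uniformOn_univ_eq_mlDeriv,
      integral_mlDeriv_zero_blocks hk f (k - 1) b₀ (by simp [hb₀])]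
  rw [hF1, hF0]
  refine norm_image_sub_le_of_norm_deriv_le_segment_01' (f' := fun r =>
    ∫ u, ∑ i, leftFactor u (b₀, i) * mlDeriv f {(b₀, i)} (scaledMeans (scaleAt b₀ r) u)
        ∂(stdBlocks (k - 1) (2 ^ n))) (fun r hr => (hasDerivAt_integral_mlDeriv_scaleAt hk f rfl
      (abs_le.2 ⟨by linarith [hr.1], hr.2⟩)).hasDerivWithinAt) fun r hr => ?_
  have hρ : ∀ b, |scaleAt b₀ r b| ≤ 1 := fun b => by
    unfold scaleAt
    split_ifs
    · exact abs_le.2 ⟨by linarith [hr.1], hr.2.le⟩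
    · simp
  have hint := integrable_abs_mlDeriv_scaledMeans hk f hρ
  have hint' : ∀ i, Integrable (fun u => leftFactor u (b₀, i) *
      mlDeriv f {(b₀, i)} (scaledMeans (scaleAt b₀ r) u)) (stdBlocks (k - 1) (2 ^ n)) := fun i =>
    (hint {(b₀, i)}).mono' ((continuous_leftFactor _).mul
      (continuous_mlDeriv_scaledMeans f _ _)).aestronglyMeasurable
        (Filter.Eventually.of_forall fun u => by
          rw [Real.norm_eq_abs, abs_mul]
          exact mul_le_of_le_one_left (abs_nonneg _) (abs_leftFactor_le _ _))
  rw [integral_finsetSum _ fun i _ => hint' i]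
  have hpath : ∀ i, |∫ u, leftFactor u (b₀, i) *
      mlDeriv f {(b₀, i)} (scaledMeans (scaleAt b₀ r) u) ∂(stdBlocks (k - 1) (2 ^ n))| ≤
      (1 / √(2 ^ n)) ^ (k - 1) * ∫ u, ∑ T ∈ extensions b₀ {(b₀, i)} k,
        |mlDeriv f T (scaledMeans (scaleAt b₀ r) u)| ∂(stdBlocks (k - 1) (2 ^ n)) := fun i => by
    have := abs_integral_path_le hk f hρ (k - 1) b₀ (by simp [hb₀]) {(b₀, i)} i
      (Finset.mem_singleton_self _) (fun p hp => by rw [Finset.mem_singleton.1 hp])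
      (fun _ => 1) 1 continuous_const (fun _ => by simp) fun _ _ _ _ => rfl
    rw [Finset.card_singleton, show 1 + (k - 1) = k by omega] at this
    simpa using this
  calc ‖∑ i, ∫ u, leftFactor u (b₀, i) *
        mlDeriv f {(b₀, i)} (scaledMeans (scaleAt b₀ r) u) ∂(stdBlocks (k - 1) (2 ^ n))‖
      ≤ ∑ i, (1 / √(2 ^ n)) ^ (k - 1) * ∫ u, ∑ T ∈ extensions b₀ {(b₀, i)} k,
        |mlDeriv f T (scaledMeans (scaleAt b₀ r) u)| ∂(stdBlocks (k - 1) (2 ^ n)) :=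
        (norm_sum_le _ _).trans (Finset.sum_le_sum fun i _ => hpath i)
    _ = (1 / √(2 ^ n)) ^ (k - 1) * ∫ u, ∑ i, ∑ T ∈ extensions b₀ {(b₀, i)} k,
        |mlDeriv f T (scaledMeans (scaleAt b₀ r) u)| ∂(stdBlocks (k - 1) (2 ^ n)) := by
        rw [integral_finsetSum _ fun i _ => integrable_finsetSum _ fun T _ => hint T,
          ← Finset.mul_sum]
    _ ≤ (1 / √(2 ^ n)) ^ (k - 1) * ∫ _u, M ∂(stdBlocks (k - 1) (2 ^ n)) := by
        refine mul_le_mul_of_nonneg_left (integral_mono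
          (integrable_finsetSum _ fun i _ => integrable_finsetSum _ fun T _ => hint T)
          (integrable_const _) fun u => ?_) (by positivity)
        refine le_trans (sum_extensions_le (fun i i' h => ?_) (fun i => Finset.filter_subset _ _)
          fun T => abs_nonneg _) (hM _ fun p => (abs_scaledMeans_le hk hρ u p).trans (by norm_num))
        simpa using h
    _ = _ := by simp

end

end

end Forrelation

/-! ### From derivatives of order `k` to the level-`k` Fourier weight -/

theorem mainTheorem2 (k n : ℕ) (hk : 2 ≤ k)
    (f : Forrelation.Cube (Fin k × Fin (2 ^ n)) → ℝ) (hf : ∀ z, f z ∈ Set.Icc (0 : ℝ) 1) :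
    BddAbove (Set.range fun μ : Fin k × Fin (2 ^ n) → Set.Icc (-1 / 2 : ℝ) (1 / 2) =>
        ∑ ℓ ∈ Finset.Icc k (k * (k - 1)),
          (1 / √((2 : ℝ) ^ n)) ^ ((ℓ : ℝ) * (1 - 1 / (k : ℝ))) * (8 * (k : ℝ)) ^ (14 * ℓ) *
            Forrelation.levelWeight (fun i => (μ i : ℝ)) ℓ f) ∧
    |∫ z, f z ∂(Forrelation.p1 k n) - ∫ z, f z ∂(Forrelation.p0 k n)| ≤
      ⨆ μ : Fin k × Fin (2 ^ n) → Set.Icc (-1 / 2 : ℝ) (1 / 2),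
        ∑ ℓ ∈ Finset.Icc k (k * (k - 1)),
          (1 / √((2 : ℝ) ^ n)) ^ ((ℓ : ℝ) * (1 - 1 / (k : ℝ))) * (8 * (k : ℝ)) ^ (14 * ℓ) *
            Forrelation.levelWeight (fun i => (μ i : ℝ)) ℓ f := by
  have hμ : ∀ (μ : Fin k × Fin (2 ^ n) → Set.Icc (-1 / 2 : ℝ) (1 / 2)) p,
      |(μ p : ℝ)| ≤ 1 / 2 := fun μ p => abs_le.2 ⟨by linarith [(μ p).2.1], (μ p).2.2⟩
  have hbdd : BddAbove (Set.range fun μ : Fin k × Fin (2 ^ n) → Set.Icc (-1 / 2 : ℝ) (1 / 2) =>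
        ∑ ℓ ∈ Finset.Icc k (k * (k - 1)),
          (1 / √((2 : ℝ) ^ n)) ^ ((ℓ : ℝ) * (1 - 1 / (k : ℝ))) * (8 * (k : ℝ)) ^ (14 * ℓ) *
            Forrelation.levelWeight (fun i => (μ i : ℝ)) ℓ f) := by
    choose C hC using Forrelation.exists_levelWeight_le f
    refine ⟨∑ ℓ ∈ Finset.Icc k (k * (k - 1)),
      (1 / √((2 : ℝ) ^ n)) ^ ((ℓ : ℝ) * (1 - 1 / (k : ℝ))) * (8 * (k : ℝ)) ^ (14 * ℓ) * C ℓ, ?_⟩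
    rintro _ ⟨μ, rfl⟩
    exact Finset.sum_le_sum fun ℓ _ =>
      mul_le_mul_of_nonneg_left (hC ℓ _ (hμ μ)) (by positivity)
  refine ⟨hbdd, ?_⟩
  set R := ⨆ μ : Fin k × Fin (2 ^ n) → Set.Icc (-1 / 2 : ℝ) (1 / 2),
        ∑ ℓ ∈ Finset.Icc k (k * (k - 1)),
          (1 / √((2 : ℝ) ^ n)) ^ ((ℓ : ℝ) * (1 - 1 / (k : ℝ))) * (8 * (k : ℝ)) ^ (14 * ℓ) *
            Forrelation.levelWeight (fun i => (μ i : ℝ)) ℓ f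
  have hk0 : (k : ℝ) ≠ 0 := by positivity
  have hα : 0 < (1 / √((2 : ℝ) ^ n)) ^ (k - 1) := by positivity
  -- At `ℓ = k` the exponent is exactly `k - 1`, the number of Hadamard entries gained along a path.
  have hexp : (1 / √((2 : ℝ) ^ n)) ^ ((k : ℝ) * (1 - 1 / (k : ℝ))) =
      (1 / √((2 : ℝ) ^ n)) ^ (k - 1) := by
    rw [← Real.rpow_natCast _ (k - 1), Nat.cast_sub (by omega)]
    congr 1
    field_simp
    simp
  have hconst : (2 : ℝ) ^ k ≤ (8 * (k : ℝ)) ^ (14 * k) := by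
    have h2 : (2 : ℝ) ≤ k := by exact_mod_cast hk
    calc (2 : ℝ) ^ k ≤ (8 * (k : ℝ)) ^ k := pow_le_pow_left₀ (by norm_num) (by linarith) k
      _ ≤ _ := pow_le_pow_right₀ (by linarith) (by omega)
  -- `M` is chosen so that the gain `N^{-(k-1)/2}` cancels and leaves `R`. The loss `2^k` from the
  -- normalization is absorbed by `(8k)^{14k}`.
  have key := Forrelation.abs_integral_sub_le (k := k) (n := n) hk f
    (M := R / (1 / √((2 : ℝ) ^ n)) ^ (k - 1)) fun μ hμ' => by
      rw [le_div_iff₀ hα]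
      have h1 : ∑ T ∈ (Finset.univ : Finset (Fin k × Fin (2 ^ n))).powersetCard k,
          |Forrelation.mlDeriv f T μ| ≤ 2 ^ k * Forrelation.levelWeight μ k f := by
        rw [Forrelation.levelWeight, Finset.mul_sum]
        refine Finset.sum_le_sum fun T hT => ?_
        have := Forrelation.abs_mlDeriv_le hμ' f T
        rwa [(Finset.mem_powersetCard.1 hT).2] at this
      have h0 := Forrelation.levelWeight_nonneg μ k f
      -- The range of levels contains `k` because `k - 1 ≥ 1`; the other summands are nonnegative
      -- and are discarded.
      have hmem : k ∈ Finset.Icc k (k * (k - 1)) :=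
        Finset.mem_Icc.2 ⟨le_rfl, Nat.le_mul_of_pos_right k (by omega)⟩
      calc _ ≤ (8 * (k : ℝ)) ^ (14 * k) * Forrelation.levelWeight μ k f *
              (1 / √((2 : ℝ) ^ n)) ^ (k - 1) :=
            mul_le_mul_of_nonneg_right (h1.trans (mul_le_mul_of_nonneg_right hconst h0)) hα.le
        _ = (1 / √((2 : ℝ) ^ n)) ^ ((k : ℝ) * (1 - 1 / (k : ℝ))) * (8 * (k : ℝ)) ^ (14 * k) *
              Forrelation.levelWeight μ k f := by
            rw [hexp]
            ring
        _ ≤ ∑ ℓ ∈ Finset.Icc k (k * (k - 1)),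
              (1 / √((2 : ℝ) ^ n)) ^ ((ℓ : ℝ) * (1 - 1 / (k : ℝ))) * (8 * (k : ℝ)) ^ (14 * ℓ) *
                Forrelation.levelWeight μ ℓ f :=
            Finset.single_le_sum (f := fun ℓ : ℕ =>
              (1 / √((2 : ℝ) ^ n)) ^ ((ℓ : ℝ) * (1 - 1 / (k : ℝ))) * (8 * (k : ℝ)) ^ (14 * ℓ) *
                Forrelation.levelWeight μ ℓ f)
              (fun ℓ _ => mul_nonneg (by positivity) (Forrelation.levelWeight_nonneg μ ℓ f)) hmem
        _ ≤ R := le_ciSup hbdd fun p =>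
            ⟨μ p, by linarith [(abs_le.1 (hμ' p)).1], (abs_le.1 (hμ' p)).2⟩
  rwa [mul_div_cancel₀ _ hα.ne'] at key
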